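/- Let $0<q<1$ and $\alpha>-1$. Write $(a;p)_n=\prod_{i=0}^{n-1}(1-ap^i)$, $(a;p)_\infty=\prod_{i=0}^{\infty}(1-ap^i)$, and $\int_0^1 g(x)\,d_qx=(1-q)\sum_{n=0}^\infty g(q^n)q^n$. For $\beta>-1$, $x\neq 0$ and $\lambda\in\mathbb C$ let $$J_\beta(x,\lambda;q^2)=\sum_{k=0}^\infty \frac{(-1)^k q^{k(k-1)+2k(\beta+1)}}{(q^2;q^2)_k\,(q^{2\beta+2};q^2)_k}\Bigl(-\frac1{x^2};q^2\Bigr)_k(\lambda x)^{2k}$$ be the big $q$-Bessel function, and let $w(x)=\dfrac{x\,(-x^2q^2;q^2)_\infty}{(-x^2q^{2\alpha+4};q^2)_\infty}$. The positive zeros of $\lambda\mapsto J_\alpha(1,\lambda;q^2)$ are simple and form an infinite increasing sequence $0<j_1^\alpha<j_2^\alpha<\cdots$. For every complex-valued $f$ with $\int_0^1 w(x)|f(x)|^2\,d_qx<\infty$, the series defining the finite big $q$-Hankel transform $$F(\lambda)=\int_0^1 w(x)\,f(x)\,J_{\alpha+1}(x,\lambda;q^2)\,d_qx$$ converges absolutely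 for every $\lambda\in\mathbb C$, and $$F(\lambda)=\sum_{k=1}^\infty 2F(j_k^\alpha)\,\frac{j_k^\alpha\,J_\alpha(1,\lambda;q^2)}{\bigl(\lambda^2-(j_k^\alpha)^2\bigr)\,\bigl[\frac{\partial J_\alpha}{\partial\lambda}(1,\lambda;q^2)\bigr]_{\lambda=j_k^\alpha}}\qquad(\lambda\in\mathbb C),$$ where the quotient in the $k$-th term, which extends to an entire function of $\lambda$, is understood as that extension at its removable singularities $\lambda=\pm j_k^\alpha$. The series converges absolutely at every $\lambda\in\mathbb C$, and uniformly on every compact subset of $\mathbb C$. -/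

import Mathlib

open Filter Topology

noncomputable section

namespace BigQBessel

/-- The finite `q`-shifted factorial `(a; q)_n = ∏_{i < n} (1 - a q^i)`. -/
def qPochhammer {R : Type*} [CommRing R] (a q : R) (n : ℕ) : R :=
  ∏ i ∈ Finset.range n, (1 - a * q ^ i)

/-- The infinite `q`-shifted factorial `(a; q)_∞ = ∏_{i ≥ 0} (1 - a q^i)`
(used only for `0 < q < 1`, where the product converges). -/
def qPochhammerInf {R : Type*} [CommRing R] [TopologicalSpace R] (a q : R) : R :=
  ∏' i : ℕ, (1 - a * q ^ i)

/-- The basic hypergeometric series `₁φ₁(a; b | q; z)`. -/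
def oneOnePhi (a b q z : ℂ) : ℂ :=
  ∑' k : ℕ, qPochhammer a q k / (qPochhammer q q k * qPochhammer b q k) *
    (-1) ^ k * q ^ (k.choose 2) * z ^ k

/-- The big `q`-Bessel function
`J_α(x, l; q²) = ₁φ₁(-1/x²; q^{2α+2} | q²; l² x² q^{2α+2})`, for `x ≠ 0`. -/
def bigQBessel (q α : ℝ) (x l : ℂ) : ℂ :=
  oneOnePhi (-1 / x ^ 2) ((q ^ (2 * α + 2) : ℝ) : ℂ) ((q : ℂ) ^ 2)
    (l ^ 2 * x ^ 2 * ((q ^ (2 * α + 2) : ℝ) : ℂ))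

/-- Absolute convergence of the series that defines the `q`-integral of `g` from `0` to `a`. -/
def QIntegrable {E : Type*} [NormedAddCommGroup E] [NormedSpace ℝ E]
    (q a : ℝ) (g : ℝ → E) : Prop :=
  Summable fun n : ℕ => q ^ n • g (a * q ^ n)

/-- The `q`-integral `∫_0^a g(t) d_q t = (1 - q) a ∑_{n ≥ 0} g(a q^n) q^n`. -/
def qIntegral {E : Type*} [NormedAddCommGroup E] [NormedSpace ℝ E]
    (q a : ℝ) (g : ℝ → E) : E :=
  ((1 - q) * a) • ∑' n : ℕ, q ^ n • g (a * q ^ n)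

/-- The weight `w(x) = x (-x² q²; q²)_∞ / (-x² q^{2α+4}; q²)_∞`. -/
def weight (q α x : ℝ) : ℝ :=
  x * qPochhammerInf (-(x ^ 2 * q ^ 2)) (q ^ 2) /
    qPochhammerInf (-(x ^ 2 * q ^ (2 * α + 4))) (q ^ 2)

/-- `f` belongs to `L²_q((0,1); w(x) d_q x)`, that is, `∫_0^1 w(x) |f(x)|² d_q x < ∞`. Only the
values of `f` on the grid `{1, q, q², …}` matter. -/
def MemL2q (q α : ℝ) (f : ℝ → ℂ) : Prop :=
  QIntegrable q 1 fun x => weight q α x * ‖f x‖ ^ 2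

/-- The integrand `w(x) f(x) J_{α+1}(x, l; q²)`. -/
def hankelIntegrand (q α : ℝ) (f : ℝ → ℂ) (l : ℂ) (x : ℝ) : ℂ :=
  (weight q α x : ℂ) * f x * bigQBessel q (α + 1) x l

/-- The finite big `q`-Hankel transform
`F(l) = ∫_0^1 w(x) f(x) J_{α+1}(x, l; q²) d_q x`. -/
def hankelTransform (q α : ℝ) (f : ℝ → ℂ) (l : ℂ) : ℂ :=
  qIntegral q 1 (hankelIntegrand q α f l)

/-- The set of positive zeros of `l ↦ J_α(1, l; q²)`. -/
def positiveZeros (q α : ℝ) : Set ℝ :=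
  {t : ℝ | 0 < t ∧ bigQBessel q α 1 (t : ℂ) = 0}

/-- The positive zeros of `l ↦ J_α(1, l; q²)` in increasing order: `besselZero q α k` is the
`(k+1)`-st one, each being the least zero above the previous one. -/
def besselZero (q α : ℝ) : ℕ → ℝ
  | 0 => sInf (positiveZeros q α)
  | k + 1 => sInf {t : ℝ | t ∈ positiveZeros q α ∧ besselZero q α k < t}

open Classical in
/-- The sampling function
`S_k(l) = 2 j J_α(1, l; q²) / ((l² - j²) ∂_l J_α(1, l; q²)|_{l = j})`, where `j` is the `(k+1)`-st
positive zero. At the two removable singularities `l = ± j` it takes its limit value, `1`. -/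
def samplingFunction (q α : ℝ) (k : ℕ) (l : ℂ) : ℂ :=
  if l ^ 2 = (besselZero q α k : ℂ) ^ 2 then 1
  else 2 * (besselZero q α k : ℂ) * bigQBessel q α 1 l /
    ((l ^ 2 - (besselZero q α k : ℂ) ^ 2) *
      deriv (fun m : ℂ => bigQBessel q α 1 m) (besselZero q α k : ℂ))

end BigQBessel

end

/-!
Write `p = q²`, `b = q^{2α+2}`, `y = x²`, `μ = λ²`. The big `q`-Bessel function becomes a power series
`φ_b(y, μ) = ∑ k, d_k(b) ∏_{i < k} (y + p^i) μ^k` (`besselSeries`), which makes sense for negative `y`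
as well. Two first-order `q`-difference relations link `φ_b` and `φ_{bp}`
(`besselSeries_sub`, `besselSeries_sub_weighted`); they are formally adjoint to each other for the
weight `v(y)` of the transform.

The functions `φ_{bp}(·, μ)` belonging to different zeros `μ` of `h(μ) = φ_b(1, μ)` are in general not
orthogonal on the grid `{p^n}` alone, since summation by parts leaves a boundary term at `y = 0`.
On the two-sided grid `{p^n} ∪ {-p^n}` the terms at `0` from the two halves cancel, and the one
at `y = -1` vanishes because the series terminates there. Summing the two
relations over this grid (`hasSum_rightOf_left`, `hasSum_rightOf_right`) gives
`Φ(μ) - b μ G Φ(μ) = h(μ) E` in `ℓ²`, where `Φ(μ)` is the suitably scaled vector of the values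
`φ_{bp}(y, μ)`, `G = ∑ U_t |r_t⟩⟨r_t|` is a compact positive operator and `E` a fixed vector
(`isResolventFamily_besselVec`).

Everything else is spectral theory. At a zero `μ` of `h` the vector `Φ(μ)` is an eigenvector of the
positive operator `G` with eigenvalue `1 / (b μ)`, so `μ > 0`. Pairing the identity with these
eigenvectors shows that the zeros are simple, that `Φ(μ_k)` and `Φ(μ_l)` are orthogonal, and that
`⟨Φ(μ_k), Φ(μ)⟩ / ‖Φ(μ_k)‖² = h(μ) / ((μ - μ_k) h'(μ_k))`, which is the sampling function
(`IsResolventFamily.inner_div_inner`, `samplingFunction_eq`). An eigenvector orthogonal to `E` would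
be orthogonal to all `Φ(μ)`, so all its moments would vanish (`eq_zero_of_inner_besselVec`); hence
every eigenspace is spanned by one `Φ(μ_k)`, and by the spectral theorem these vectors form an
orthogonal basis (`IsResolventFamily.orthogonal_span_eq_bot`). The transform of `f` is the pairing of
`Φ(λ²)` with the vector of `f`, extended by zero to negative `y`, and the sampling formula is
Parseval's identity. The remainder of the expansion of that vector tends to zero in norm, and `Φ` is
bounded on compact sets, so the convergence is locally uniform.
-/

open Filter Topology

/-! ### Families of vectors with a rank-one resolvent defect -/

namespace BigQBessel

section ResolventFamily

open scoped InnerProductSpace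

variable {H : Type*} [NormedAddCommGroup H] [InnerProductSpace ℂ H]

/-- An entire family `Φ` of vectors of a Hilbert space with `(1 - β μ G) Φ(μ) = h(μ) E` for a
compact positive operator `G`, a fixed vector `E` and an entire function `h`. At the zeros of `h`
the vector `Φ(μ)` is an eigenvector of `G`; the conditions `inner_eq_zero_of_ker` and `total` make
these eigenvectors exhaust the spectrum. -/
structure IsResolventFamily (G : H →L[ℂ] H) (β : ℝ) (E : H) (Φ : ℂ → H) (h : ℂ → ℂ) : Prop where
  pos : 0 < β
  compact : IsCompactOperator G
  symm : G.IsSymmetric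
  nonneg : ∀ x, 0 ≤ (⟪x, G x⟫_ℂ).re
  inner_eq_zero_of_ker : ∀ x, G x = 0 → ⟪x, E⟫_ℂ = 0
  resolvent_eq : ∀ μ, Φ μ - ((β : ℂ) * μ) • G (Φ μ) = h μ • E
  total : ∀ x, (∀ μ, ⟪x, Φ μ⟫_ℂ = 0) → x = 0
  differentiable : Differentiable ℂ Φ
  differentiable_charFun : Differentiable ℂ h
  charFun_zero : h 0 = 1
  ne_zero : ∀ μ, Φ μ ≠ 0

/-- The positive numbers `t` with `h(t²) = 0`. -/
def sqrtZeros (h : ℂ → ℂ) : Set ℝ := {t : ℝ | 0 < t ∧ h ((t : ℂ) ^ 2) = 0}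

namespace IsResolventFamily

variable {G : H →L[ℂ] H} {β : ℝ} {E : H} {Φ : ℂ → H} {h : ℂ → ℂ}

lemma ne_zero_of_zero (D : IsResolventFamily G β E Φ h) {μ : ℂ} (hμ : h μ = 0) : μ ≠ 0 := by
  rintro rfl
  simp [D.charFun_zero] at hμ

lemma apply_eq (D : IsResolventFamily G β E Φ h) {μ : ℂ} (hμ : h μ = 0) :
    G (Φ μ) = ((β : ℂ) * μ)⁻¹ • Φ μ := by
  have h1 := D.resolvent_eq μ
  have hβ : (β : ℂ) * μ ≠ 0 :=
    mul_ne_zero (by exact_mod_cast D.pos.ne') (D.ne_zero_of_zero hμ)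
  rw [hμ, zero_smul, sub_eq_zero] at h1
  rw [eq_inv_smul_iff₀ hβ]
  exact h1.symm

/-- Pairing the resolvent equation with an eigenvector of `G`. -/
lemma inner_eigenvector (D : IsResolventFamily G β E Φ h) {x : H} {ν : ℂ} (hx : G x = ν • x)
    (hν : (starRingEnd ℂ) ν = ν) (μ : ℂ) :
    (1 - β * μ * ν) * ⟪x, Φ μ⟫_ℂ = h μ * ⟪x, E⟫_ℂ := by
  have h1 := congrArg (fun z => ⟪x, z⟫_ℂ) (D.resolvent_eq μ)
  have h2 : ⟪x, G (Φ μ)⟫_ℂ = ν * ⟪x, Φ μ⟫_ℂ := by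
    rw [← ContinuousLinearMap.coe_coe, ← D.symm x (Φ μ), ContinuousLinearMap.coe_coe, hx,
      inner_smul_left, hν]
  simp only [inner_sub_right, inner_smul_right, h2] at h1
  linear_combination h1

lemma conj_eigenvalue (D : IsResolventFamily G β E Φ h) {x : H} {ν : ℂ} (hx : G x = ν • x)
    (hx0 : x ≠ 0) : (starRingEnd ℂ) ν = ν :=
  D.symm.conj_eigenvalue_eq_self (Module.End.hasEigenvalue_of_hasEigenvector
    (x := x) ⟨Module.End.mem_eigenspace_iff.2 hx, hx0⟩)

/-- The zeros of `h` are positive real numbers. -/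
lemma exists_sqrt (D : IsResolventFamily G β E Φ h) {μ : ℂ} (hμ : h μ = 0) :
    ∃ t : ℝ, 0 < t ∧ μ = (t : ℂ) ^ 2 := by
  have hμ0 := D.ne_zero_of_zero hμ
  have hG := D.apply_eq hμ
  have hconj := D.conj_eigenvalue hG (D.ne_zero μ)
  have hβ : (β : ℂ) ≠ 0 := by exact_mod_cast D.pos.ne'
  obtain ⟨ν, hν⟩ := Complex.conj_eq_iff_real.1 hconj
  have hνpos : 0 ≤ ν := by
    have h1 := D.nonneg (Φ μ)
    rw [hG, hν, inner_smul_right, inner_self_eq_norm_sq_to_K] at h1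
    have h2 : 0 < ‖Φ μ‖ ^ 2 := by have := norm_pos_iff.2 (D.ne_zero μ); positivity
    have h3 : ((ν : ℂ) * ((‖Φ μ‖ : ℝ) : ℂ) ^ 2).re = ν * ‖Φ μ‖ ^ 2 := by
      rw [← Complex.ofReal_pow, ← Complex.ofReal_mul, Complex.ofReal_re]
    have h4 : 0 ≤ ν * ‖Φ μ‖ ^ 2 := by rw [← h3]; exact h1
    exact nonneg_of_mul_nonneg_left h4 h2
  have hμν : μ = (((β * ν)⁻¹ : ℝ) : ℂ) := by
    push_cast
    rw [← hν]
    field_simp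
  have hne : (β * ν)⁻¹ ≠ 0 := by
    intro h0
    rw [h0] at hμν
    exact hμ0 (by simpa using hμν)
  have hpos : 0 < (β * ν)⁻¹ :=
    lt_of_le_of_ne (inv_nonneg.2 (mul_nonneg D.pos.le hνpos)) hne.symm
  refine ⟨Real.sqrt ((β * ν)⁻¹), Real.sqrt_pos.2 hpos, ?_⟩
  rw [hμν, ← Complex.ofReal_pow, Real.sq_sqrt hpos.le]

/-- At a zero `t²` of `h` the pairing of `Φ(t²)` with `Φ(μ)` is a multiple of `h(μ) / (t² - μ)`. -/
lemma inner_zero_mul (D : IsResolventFamily G β E Φ h) {t : ℝ} (ht : t ∈ sqrtZeros h) (μ : ℂ) :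
    ((t : ℂ) ^ 2 - μ) * ⟪Φ ((t : ℂ) ^ 2), Φ μ⟫_ℂ =
      (t : ℂ) ^ 2 * (h μ * ⟪Φ ((t : ℂ) ^ 2), E⟫_ℂ) := by
  have hG := D.apply_eq ht.2
  have ht0 : (t : ℂ) ≠ 0 := by exact_mod_cast ht.1.ne'
  have hβ : (β : ℂ) ≠ 0 := by exact_mod_cast D.pos.ne'
  rw [← D.inner_eigenvector hG (D.conj_eigenvalue hG (D.ne_zero _)) μ]
  field_simp

lemma inner_zero_zero (D : IsResolventFamily G β E Φ h) {s t : ℝ} (hs : s ∈ sqrtZeros h)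
    (ht : t ∈ sqrtZeros h) (hst : s ≠ t) : ⟪Φ ((s : ℂ) ^ 2), Φ ((t : ℂ) ^ 2)⟫_ℂ = 0 := by
  have h1 := D.inner_zero_mul hs ((t : ℂ) ^ 2)
  rw [ht.2, zero_mul, mul_zero, mul_eq_zero] at h1
  refine h1.resolve_left fun h2 => hst ?_
  have h3 : s ^ 2 = t ^ 2 := by exact_mod_cast sub_eq_zero.1 h2
  exact (pow_left_inj₀ hs.1.le ht.1.le two_ne_zero).1 h3

/-- Every zero of `h` is simple: the derivative there is a nonzero multiple of `‖Φ‖²`. -/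
lemma inner_self_eq (D : IsResolventFamily G β E Φ h) {t : ℝ} (ht : t ∈ sqrtZeros h) :
    -⟪Φ ((t : ℂ) ^ 2), Φ ((t : ℂ) ^ 2)⟫_ℂ =
      (t : ℂ) ^ 2 * (deriv h ((t : ℂ) ^ 2) * ⟪Φ ((t : ℂ) ^ 2), E⟫_ℂ) := by
  set μ₀ : ℂ := (t : ℂ) ^ 2
  have hg : Differentiable ℂ fun μ => ⟪Φ μ₀, Φ μ⟫_ℂ :=
    ((innerSL ℂ (Φ μ₀)).differentiable).comp D.differentiable
  have h1 : HasDerivAt (fun μ : ℂ => (μ₀ - μ) * ⟪Φ μ₀, Φ μ⟫_ℂ)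
      ((-1) * ⟪Φ μ₀, Φ μ₀⟫_ℂ + (μ₀ - μ₀) * deriv (fun μ => ⟪Φ μ₀, Φ μ⟫_ℂ) μ₀) μ₀ :=
    ((hasDerivAt_id μ₀).const_sub μ₀).mul (hg μ₀).hasDerivAt
  have h2 : HasDerivAt (fun μ : ℂ => μ₀ * (h μ * ⟪Φ μ₀, E⟫_ℂ))
      (μ₀ * (deriv h μ₀ * ⟪Φ μ₀, E⟫_ℂ)) μ₀ :=
    ((D.differentiable_charFun μ₀).hasDerivAt.mul_const _).const_mul _
  rw [funext (D.inner_zero_mul ht)] at h1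
  simpa using h1.unique h2

lemma deriv_charFun_ne_zero (D : IsResolventFamily G β E Φ h) {t : ℝ} (ht : t ∈ sqrtZeros h) :
    deriv h ((t : ℂ) ^ 2) ≠ 0 := by
  intro h0
  have h1 := D.inner_self_eq ht
  rw [h0, zero_mul, mul_zero, neg_eq_zero, inner_self_eq_zero] at h1
  exact D.ne_zero _ h1

/-- The normalized pairing of `Φ(t²)` with `Φ(μ)` is the Lagrange interpolation function of `h`
at its zero `t²`. -/
lemma inner_div_inner (D : IsResolventFamily G β E Φ h) {t : ℝ} (ht : t ∈ sqrtZeros h) {μ : ℂ}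
    (hμ : μ ≠ (t : ℂ) ^ 2) :
    ⟪Φ ((t : ℂ) ^ 2), Φ μ⟫_ℂ / ⟪Φ ((t : ℂ) ^ 2), Φ ((t : ℂ) ^ 2)⟫_ℂ =
      h μ / ((μ - (t : ℂ) ^ 2) * deriv h ((t : ℂ) ^ 2)) := by
  have h1 := D.inner_zero_mul ht μ
  have h2 := D.inner_self_eq ht
  have h3 : ⟪Φ ((t : ℂ) ^ 2), Φ ((t : ℂ) ^ 2)⟫_ℂ ≠ 0 := by
    simpa using D.ne_zero _
  rw [div_eq_div_iff h3 (mul_ne_zero (sub_ne_zero.2 hμ) (D.deriv_charFun_ne_zero ht))]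
  linear_combination (-deriv h ((t : ℂ) ^ 2)) * h1 + h μ * h2

/-- An eigenvector orthogonal to `E` vanishes, since it is orthogonal to every `Φ(μ)`. -/
lemma eigenvector_eq_zero (D : IsResolventFamily G β E Φ h) {x : H} {ν : ℂ}
    (hx : G x = ν • x) (hE : ⟪x, E⟫_ℂ = 0) : x = 0 := by
  by_contra hx0
  have hconj := D.conj_eigenvalue hx hx0
  have key : ∀ μ, β * μ * ν ≠ 1 → ⟪x, Φ μ⟫_ℂ = 0 := by
    intro μ hμ
    have h1 := D.inner_eigenvector hx hconj μ
    rw [hE, mul_zero, mul_eq_zero] at h1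
    exact h1.resolve_left fun h2 => hμ (sub_eq_zero.1 h2).symm
  refine hx0 (D.total x fun μ => ?_)
  by_cases hμ : β * μ * ν ≠ 1
  · exact key μ hμ
  -- at the excluded point `μ = 1 / (β ν)` the pairing vanishes by continuity
  push Not at hμ
  have hβν : (β : ℂ) * ν ≠ 0 := by
    intro h0
    rw [mul_right_comm, h0, zero_mul] at hμ
    exact zero_ne_one hμ
  have hc : Continuous fun μ => ⟪x, Φ μ⟫_ℂ := continuous_const.inner D.differentiable.continuous
  have h1 : Tendsto (fun μ => ⟪x, Φ μ⟫_ℂ) (𝓝[≠] μ) (𝓝 ⟪x, Φ μ⟫_ℂ) :=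
    (hc.tendsto μ).mono_left nhdsWithin_le_nhds
  refine tendsto_nhds_unique_of_eventuallyEq h1 tendsto_const_nhds ?_
  filter_upwards [self_mem_nhdsWithin] with z hz
  refine key z fun h2 => hz ?_
  have h3 : (β : ℂ) * ν * (z - μ) = 0 := by linear_combination h2 - hμ
  exact sub_eq_zero.1 ((mul_eq_zero.1 h3).resolve_left hβν)

lemma eigenvector_mem_span (D : IsResolventFamily G β E Φ h) {x : H} {ν : ℂ}
    (hx : G x = ν • x) :
    x ∈ Submodule.span ℂ (Set.range fun t : sqrtZeros h => Φ (((t : ℝ) : ℂ) ^ 2)) := by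
  by_cases hx0 : x = 0
  · rw [hx0]; exact zero_mem _
  have hβ : (β : ℂ) ≠ 0 := by exact_mod_cast D.pos.ne'
  have hE : ⟪x, E⟫_ℂ ≠ 0 := fun h0 => hx0 (D.eigenvector_eq_zero hx h0)
  have hν : ν ≠ 0 := by
    rintro rfl
    exact hE (D.inner_eq_zero_of_ker x (by simpa using hx))
  have hconj := D.conj_eigenvalue hx hx0
  have hzero : h ((β * ν)⁻¹) = 0 := by
    have h1 := D.inner_eigenvector hx hconj ((β * ν)⁻¹)
    have h2 : 1 - (β : ℂ) * (β * ν)⁻¹ * ν = 0 := by field_simp; simp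
    rw [h2, zero_mul, eq_comm, mul_eq_zero] at h1
    exact h1.resolve_right hE
  obtain ⟨t, ht, hμ⟩ := D.exists_sqrt hzero
  rw [hμ] at hzero
  have hG := D.apply_eq hzero
  have hν' : ((β : ℂ) * (t : ℂ) ^ 2)⁻¹ = ν := by rw [← hμ]; field_simp
  rw [hν'] at hG
  set y := Φ ((t : ℂ) ^ 2) with hy
  have hyE : ⟪y, E⟫_ℂ ≠ 0 := fun h0 => D.ne_zero _ (D.eigenvector_eq_zero hG h0)
  -- eliminate the `E`-component of `x` by subtracting a multiple of `y`
  set c : ℂ := (starRingEnd ℂ) (⟪x, E⟫_ℂ / ⟪y, E⟫_ℂ) with hc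
  have hz : x - c • y = 0 := by
    refine D.eigenvector_eq_zero (ν := ν) ?_ ?_
    · rw [map_sub, map_smul, hx, hG, smul_sub, smul_comm]
    · rw [inner_sub_left, inner_smul_left, hc, Complex.conj_conj, div_mul_cancel₀ _ hyE, sub_self]
  rw [sub_eq_zero.1 hz]
  exact Submodule.smul_mem _ _ (Submodule.subset_span ⟨⟨t, ht, hzero⟩, rfl⟩)

lemma orthogonal_span_eq_bot [CompleteSpace H] (D : IsResolventFamily G β E Φ h) :
    (Submodule.span ℂ (Set.range fun t : sqrtZeros h => Φ (((t : ℝ) : ℂ) ^ 2)))ᗮ = ⊥ := by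
  rw [eq_bot_iff, ← ContinuousLinearMap.orthogonalComplement_iSup_eigenspaces_eq_bot
    D.compact D.symm]
  refine Submodule.orthogonal_le (iSup_le fun ν x hx => ?_)
  exact D.eigenvector_mem_span (Module.End.mem_eigenspace_iff.1 hx)

lemma orthonormal_normalize (D : IsResolventFamily G β E Φ h) :
    Orthonormal ℂ fun t : sqrtZeros h =>
      ((‖Φ (((t : ℝ) : ℂ) ^ 2)‖ : ℂ)⁻¹) • Φ (((t : ℝ) : ℂ) ^ 2) := by
  refine ⟨fun t => norm_smul_inv_norm (D.ne_zero _), fun s t hst => ?_⟩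
  simp only [inner_smul_left, inner_smul_right,
    D.inner_zero_zero s.2 t.2 fun h => hst (Subtype.ext h), mul_zero]

/-- The normalized eigenvectors `Φ(t²)`, for `t²` a zero of `h`, form a Hilbert basis. -/
noncomputable def hilbertBasis [CompleteSpace H] (D : IsResolventFamily G β E Φ h) :
    HilbertBasis (sqrtZeros h) ℂ H :=
  HilbertBasis.mkOfOrthogonalEqBot D.orthonormal_normalize <| by
    rw [eq_bot_iff, ← D.orthogonal_span_eq_bot]
    refine Submodule.orthogonal_le (Submodule.span_le.2 ?_)
    rintro _ ⟨t, rfl⟩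
    have h1 : ((‖Φ (((t : ℝ) : ℂ) ^ 2)‖ : ℂ)) ≠ 0 := by
      simpa using D.ne_zero _
    have h2 := Submodule.smul_mem _ ((‖Φ (((t : ℝ) : ℂ) ^ 2)‖ : ℂ)) (Submodule.subset_span
      (R := ℂ) (s := Set.range fun t : sqrtZeros h =>
        ((‖Φ (((t : ℝ) : ℂ) ^ 2)‖ : ℂ)⁻¹) • Φ (((t : ℝ) : ℂ) ^ 2)) ⟨t, rfl⟩)
    rwa [smul_inv_smul₀ h1] at h2

lemma hilbertBasis_apply [CompleteSpace H] (D : IsResolventFamily G β E Φ h)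
    (t : sqrtZeros h) :
    D.hilbertBasis t = ((‖Φ (((t : ℝ) : ℂ) ^ 2)‖ : ℂ)⁻¹) • Φ (((t : ℝ) : ℂ) ^ 2) := by
  simp [hilbertBasis]

lemma infinite_sqrtZeros [CompleteSpace H] (D : IsResolventFamily G β E Φ h)
    (hH : ¬ FiniteDimensional ℂ H) : (sqrtZeros h).Infinite := by
  intro hfin
  have := hfin.fintype
  exact hH (Module.Basis.finiteDimensional_of_finite
    D.hilbertBasis.toOrthonormalBasis.toBasis)

lemma finite_sqrtZeros_inter (D : IsResolventFamily G β E Φ h) (R : ℝ) :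
    (sqrtZeros h ∩ Set.Iic R).Finite := by
  by_contra hinf
  -- otherwise the zeros accumulate in `[0, R]`, and the entire function `t ↦ h(t²)` vanishes
  have hsub : sqrtZeros h ∩ Set.Iic R ⊆ Set.Icc 0 R := fun t ht => ⟨ht.1.1.le, ht.2⟩
  obtain ⟨z, -, hz⟩ := Set.Infinite.exists_accPt_of_subset_isCompact hinf isCompact_Icc hsub
  have han : AnalyticOnNhd ℂ (fun l : ℂ => h (l ^ 2)) Set.univ :=
    (D.differentiable_charFun.comp (differentiable_pow 2)).differentiableOn.analyticOnNhd isOpen_univ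
  have hfreq : ∃ᶠ l in 𝓝[≠] (z : ℂ), h (l ^ 2) = 0 := by
    rw [accPt_iff_frequently_nhdsNE] at hz
    have ht : Tendsto (fun t : ℝ => (t : ℂ)) (𝓝[≠] z) (𝓝[≠] (z : ℂ)) :=
      Complex.continuous_ofReal.continuousWithinAt.tendsto_nhdsWithin
        fun t ht => by simpa using ht
    exact ht.frequently (hz.mono fun t ht => ht.1.2)
  have h0 := han.eqOn_zero_of_preconnected_of_frequently_eq_zero isPreconnected_univ
    (Set.mem_univ (z : ℂ)) hfreq (Set.mem_univ 0)
  simp [D.charFun_zero] at h0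

/-- Parseval's identity in the eigenbasis. -/
lemma hasSum_inner [CompleteSpace H] (D : IsResolventFamily G β E Φ h) (x : H) (μ : ℂ) :
    HasSum (fun t : sqrtZeros h => ⟪x, Φ (((t : ℝ) : ℂ) ^ 2)⟫_ℂ *
      (⟪Φ (((t : ℝ) : ℂ) ^ 2), Φ μ⟫_ℂ / ⟪Φ (((t : ℝ) : ℂ) ^ 2), Φ (((t : ℝ) : ℂ) ^ 2)⟫_ℂ))
      ⟪x, Φ μ⟫_ℂ := by
  refine (D.hilbertBasis.hasSum_inner_mul_inner x (Φ μ)).congr_fun fun t => ?_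
  have h1 : ((‖Φ (((t : ℝ) : ℂ) ^ 2)‖ : ℂ)) ≠ 0 := by
    simpa using D.ne_zero _
  rw [hilbertBasis_apply, inner_smul_right, inner_smul_left, inner_self_eq_norm_sq_to_K, map_inv₀,
    Complex.conj_ofReal]
  simp only [Complex.coe_algebraMap]
  field_simp

/-- The partial sums of Parseval's identity converge uniformly on compact sets of `μ`: the error is
the pairing of `Φ(μ)` with the remainder of the expansion of `x`. -/
lemma tendstoUniformlyOn_inner [CompleteSpace H] (D : IsResolventFamily G β E Φ h)
    (e : ℕ ≃ sqrtZeros h) (x : H) {K : Set ℂ} (hK : IsCompact K) :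
    TendstoUniformlyOn (fun (N : ℕ) (μ : ℂ) => ∑ k ∈ Finset.range N,
      ⟪x, Φ (((e k : ℝ) : ℂ) ^ 2)⟫_ℂ * (⟪Φ (((e k : ℝ) : ℂ) ^ 2), Φ μ⟫_ℂ /
        ⟪Φ (((e k : ℝ) : ℂ) ^ 2), Φ (((e k : ℝ) : ℂ) ^ 2)⟫_ℂ))
      (fun μ => ⟪x, Φ μ⟫_ℂ) atTop K := by
  set b := D.hilbertBasis with hb
  have hsum : HasSum (fun k => b.repr x (e k) • b (e k)) x :=
    (e.hasSum_iff (f := fun t => b.repr x t • b t)).2 (b.hasSum_repr x)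
  have hlim := hsum.tendsto_sum_nat
  obtain ⟨C, hC⟩ := hK.exists_bound_of_continuousOn D.differentiable.continuous.continuousOn
  have hterm : ∀ k μ, ⟪x, Φ (((e k : ℝ) : ℂ) ^ 2)⟫_ℂ * (⟪Φ (((e k : ℝ) : ℂ) ^ 2), Φ μ⟫_ℂ /
      ⟪Φ (((e k : ℝ) : ℂ) ^ 2), Φ (((e k : ℝ) : ℂ) ^ 2)⟫_ℂ) =
      ⟪b.repr x (e k) • b (e k), Φ μ⟫_ℂ := by
    intro k μ
    have h1 : ((‖Φ (((e k : ℝ) : ℂ) ^ 2)‖ : ℂ)) ≠ 0 := by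
      simpa using D.ne_zero _
    rw [b.repr_apply_apply, inner_smul_left, inner_conj_symm, hb, hilbertBasis_apply,
      inner_smul_right, inner_smul_left, inner_self_eq_norm_sq_to_K, map_inv₀,
      Complex.conj_ofReal]
    simp only [Complex.coe_algebraMap]
    field_simp
  rw [Metric.tendstoUniformlyOn_iff]
  intro ε hε
  have hC0 : 0 < |C| + 1 := by positivity
  have hev := (Metric.tendsto_nhds.1 hlim) (ε / (|C| + 1)) (div_pos hε hC0)
  filter_upwards [hev] with N hN μ hμ
  simp only [hterm, ← sum_inner]
  rw [dist_eq_norm, ← inner_sub_left]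
  rw [dist_comm, dist_eq_norm] at hN
  calc _ ≤ _ := norm_inner_le_norm _ _
    _ ≤ ‖x - ∑ i ∈ Finset.range N, b.repr x (e i) • b (e i)‖ * (|C| + 1) := by
      gcongr
      exact (hC μ hμ).trans ((le_abs_self C).trans (by linarith))
    _ < ε := by rwa [← lt_div_iff₀ hC0]

end IsResolventFamily

end ResolventFamily

end BigQBessel

/-! ### Enumeration of zeros, sums of rank-one operators, power series -/

namespace BigQBessel

section Enumeration

/-- The recursion that defines `besselZero` enumerates the positive zeros increasingly, as soon as
they are infinite in number and locally finite. -/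
lemma besselZero_enumerates {q α : ℝ} (hinf : (positiveZeros q α).Infinite)
    (hfin : ∀ R : ℝ, (positiveZeros q α ∩ Set.Iic R).Finite) :
    StrictMono (besselZero q α) ∧ Set.range (besselZero q α) = positiveZeros q α := by
  have hmem : ∀ S : Set ℝ, S ⊆ positiveZeros q α → S.Nonempty → sInf S ∈ S ∧ ∀ t ∈ S, sInf S ≤ t := by
    intro S hS ⟨s, hs⟩
    have hbdd : BddBelow S := ⟨0, fun t ht => (hS ht).1.le⟩
    have hf : (S ∩ Set.Iic s).Finite := (hfin s).subset (Set.inter_subset_inter_left _ hS)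
    obtain ⟨m, hm, hmin⟩ := Set.exists_min_image (S ∩ Set.Iic s) id hf ⟨s, hs, le_refl s⟩
    have hle : ∀ t ∈ S, m ≤ t := by
      intro t ht
      rcases le_total t s with h | h
      · exact hmin t ⟨ht, h⟩
      · exact le_trans hm.2 h
    have hmS : sInf S = m := le_antisymm (csInf_le hbdd hm.1) (le_csInf ⟨s, hs⟩ hle)
    rw [hmS]
    exact ⟨hm.1, hle⟩
  have hne : ∀ R : ℝ, {t : ℝ | t ∈ positiveZeros q α ∧ R < t}.Nonempty := by
    intro R
    by_contra h
    rw [Set.not_nonempty_iff_eq_empty] at h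
    refine hinf ((hfin R).subset fun t ht => ⟨ht, ?_⟩)
    by_contra h2
    have h3 : t ∈ {t : ℝ | t ∈ positiveZeros q α ∧ R < t} := ⟨ht, not_le.1 h2⟩
    rw [h] at h3
    exact h3
  have hzero := hmem (positiveZeros q α) subset_rfl hinf.nonempty
  have hsucc := fun k => hmem {t : ℝ | t ∈ positiveZeros q α ∧ besselZero q α k < t}
    (fun t ht => ht.1) (hne _)
  have hmono : StrictMono (besselZero q α) := strictMono_nat_of_lt_succ fun k => (hsucc k).1.2
  have hin : ∀ k, besselZero q α k ∈ positiveZeros q α := by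
    rintro (_ | k)
    · exact hzero.1
    · exact (hsucc k).1.1
  refine ⟨hmono, Set.Subset.antisymm (Set.range_subset_iff.2 hin) fun t ht => ?_⟩
  by_contra hnot
  -- a zero that is missed lies above all the enumerated ones
  have hlt : ∀ k, besselZero q α k < t := by
    intro k
    induction k with
    | zero => exact lt_of_le_of_ne (hzero.2 t ht) fun h => hnot ⟨0, h⟩
    | succ k ih => exact lt_of_le_of_ne ((hsucc k).2 t ⟨ht, ih⟩) fun h => hnot ⟨k + 1, h⟩
  exact Set.infinite_range_of_injective hmono.injective
    ((hfin t).subset (Set.range_subset_iff.2 fun k => ⟨hin k, (hlt k).le⟩))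

end Enumeration

section SumRankOne

open scoped InnerProductSpace

variable {ι H : Type*} [NormedAddCommGroup H] [InnerProductSpace ℂ H]

/-- The operator `∑ t, U t • |r t⟩⟨r t|`. -/
noncomputable def sumRankOne (U : ι → ℝ) (r : ι → H) : H →L[ℂ] H :=
  ∑' t, (U t : ℂ) • InnerProductSpace.rankOne ℂ (r t) (r t)

variable [CompleteSpace H] {U : ι → ℝ} {r : ι → H} {B : ℝ}

lemma hasSum_sumRankOne (hU : Summable U) (hU0 : ∀ t, 0 ≤ U t) (hr : ∀ t, ‖r t‖ ≤ B) :
    HasSum (fun t => (U t : ℂ) • InnerProductSpace.rankOne ℂ (r t) (r t)) (sumRankOne U r) := by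
  refine (Summable.of_norm_bounded (hU.mul_right (B * B)) fun t => ?_).hasSum
  rw [norm_smul, InnerProductSpace.norm_rankOne, Complex.norm_real, Real.norm_of_nonneg (hU0 t)]
  have := norm_nonneg (r t)
  gcongr
  · exact hU0 t
  · exact this.trans (hr t)
  · exact hr t
  · exact hr t

lemma hasSum_sumRankOne_apply (hU : Summable U) (hU0 : ∀ t, 0 ≤ U t) (hr : ∀ t, ‖r t‖ ≤ B)
    (x : H) : HasSum (fun t => ((U t : ℂ) * ⟪r t, x⟫_ℂ) • r t) (sumRankOne U r x) := by
  simpa [mul_smul] using (hasSum_sumRankOne hU hU0 hr).mapL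
    (ContinuousLinearMap.apply ℂ H x)

lemma isCompactOperator_sumRankOne (hU : Summable U) (hU0 : ∀ t, 0 ≤ U t)
    (hr : ∀ t, ‖r t‖ ≤ B) : IsCompactOperator (sumRankOne U r) := by
  refine isCompactOperator_of_tendsto (hasSum_sumRankOne hU hU0 hr) (Eventually.of_forall fun s => ?_)
  refine Submodule.sum_mem (compactOperator (RingHom.id ℂ) H H) fun t _ =>
    Submodule.smul_mem _ _ ?_
  change IsCompactOperator (InnerProductSpace.rankOne ℂ (r t) (r t))
  rw [InnerProductSpace.rankOne_def']
  have hid : IsCompactOperator (id : ℂ → ℂ) := (isCompactOperator_id_iff_finiteDimensional (𝕜 := ℂ)).2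
    inferInstance
  exact (hid.comp_clm (innerSL ℂ (r t))).clm_comp (ContinuousLinearMap.toSpanSingleton ℂ (r t))

lemma hasSum_inner_sumRankOne (hU : Summable U) (hU0 : ∀ t, 0 ≤ U t) (hr : ∀ t, ‖r t‖ ≤ B)
    (x y : H) : HasSum (fun t => (U t : ℂ) * ⟪r t, x⟫_ℂ * ⟪y, r t⟫_ℂ) ⟪y, sumRankOne U r x⟫_ℂ := by
  simpa [inner_smul_right] using (hasSum_sumRankOne_apply hU hU0 hr x).mapL (innerSL ℂ y)

lemma isSymmetric_sumRankOne (hU : Summable U) (hU0 : ∀ t, 0 ≤ U t) (hr : ∀ t, ‖r t‖ ≤ B) :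
    (sumRankOne U r).IsSymmetric := by
  intro x y
  have h1 := hasSum_inner_sumRankOne hU hU0 hr x y
  have h2 := hasSum_inner_sumRankOne hU hU0 hr y x
  rw [ContinuousLinearMap.coe_coe, ← inner_conj_symm, ← h1.tsum_eq, ← h2.tsum_eq,
    ← Complex.conjCLE_apply, ContinuousLinearEquiv.map_tsum]
  congr 1
  ext t
  simp only [Complex.conjCLE_apply, map_mul, Complex.conj_ofReal, inner_conj_symm]
  ring

lemma hasSum_re_inner_sumRankOne (hU : Summable U) (hU0 : ∀ t, 0 ≤ U t) (hr : ∀ t, ‖r t‖ ≤ B)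
    (x : H) : HasSum (fun t => U t * ‖⟪r t, x⟫_ℂ‖ ^ 2) (⟪x, sumRankOne U r x⟫_ℂ).re := by
  refine (Complex.hasSum_re (hasSum_inner_sumRankOne hU hU0 hr x x)).congr_fun fun t => ?_
  rw [← inner_conj_symm x (r t), mul_assoc, Complex.mul_conj, ← Complex.ofReal_mul,
    Complex.ofReal_re, Complex.normSq_eq_norm_sq]

lemma re_inner_sumRankOne_nonneg (hU : Summable U) (hU0 : ∀ t, 0 ≤ U t) (hr : ∀ t, ‖r t‖ ≤ B)
    (x : H) : 0 ≤ (⟪x, sumRankOne U r x⟫_ℂ).re :=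
  (hasSum_re_inner_sumRankOne hU hU0 hr x).nonneg fun t => mul_nonneg (hU0 t) (by positivity)

lemma inner_eq_zero_of_sumRankOne_eq_zero (hU : Summable U) (hU0 : ∀ t, 0 < U t)
    (hr : ∀ t, ‖r t‖ ≤ B) {x : H} (hx : sumRankOne U r x = 0) (t : ι) : ⟪r t, x⟫_ℂ = 0 := by
  have h1 := hasSum_re_inner_sumRankOne hU (fun t => (hU0 t).le) hr x
  rw [hx, inner_zero_right, Complex.zero_re] at h1
  have h2 := congrFun ((hasSum_zero_iff_of_nonneg
    fun t => mul_nonneg (hU0 t).le (by positivity)).1 h1) t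
  simpa [(hU0 t).ne'] using h2

end SumRankOne

section PowerSeries

/-- Identity theorem for power series, in terms of sums that vanish at points tending to `0`. -/
lemma coeff_eq_zero_of_frequently {c : ℕ → ℂ}
    (hs : ∀ z : ℂ, ‖z‖ < 1 → Summable fun n => c n * z ^ n)
    (hz : ∃ᶠ z in 𝓝[≠] (0 : ℂ), ∑' n, c n * z ^ n = 0) (n : ℕ) : c n = 0 := by
  set p : FormalMultilinearSeries ℂ ℂ ℂ := FormalMultilinearSeries.ofScalars ℂ c
  have hp : HasFPowerSeriesAt (fun z => ∑' n, c n * z ^ n) p 0 := by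
    rw [hasFPowerSeriesAt_iff]
    filter_upwards [Metric.ball_mem_nhds (0 : ℂ) one_pos] with z hz
    rw [zero_add]
    refine (hs z (by simpa using hz)).hasSum.congr_fun fun n => ?_
    simp [p, FormalMultilinearSeries.coeff_ofScalars, mul_comm]
  have h1 := (hp.analyticAt.frequently_zero_iff_eventually_zero).1 hz
  have h2 : p = 0 := (hp.congr h1).eq_zero
  have h3 : p.coeff n = 0 := by rw [h2]; rfl
  simpa [p, FormalMultilinearSeries.coeff_ofScalars] using h3

end PowerSeries

end BigQBessel

/-! ### The Bessel series and its difference relations -/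

namespace BigQBessel

section Series

/-- The polynomial `∏_{i < k} (y + p^i)`; for `y = x²` it equals `x^{2k} (-1/x²; p)_k`. -/
noncomputable def shiftProd (p y : ℝ) (k : ℕ) : ℝ := ∏ i ∈ Finset.range k, (y + p ^ i)

/-- The coefficient `(-1)^k p^{k(k-1)/2} b^k / ((p; p)_k (b; p)_k)`. -/
noncomputable def seriesCoeff (p b : ℝ) (k : ℕ) : ℝ :=
  (-1) ^ k * p ^ k.choose 2 * b ^ k / (qPochhammer p p k * qPochhammer b p k)

/-- The big `q`-Bessel function in the variables `y = x²`, `μ = λ²`, with base `p = q²` and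
parameter `b = q^{2α+2}`. Unlike `bigQBessel`, it also makes sense for `y ≤ 0`. -/
noncomputable def besselSeries (p b y : ℝ) (μ : ℂ) : ℂ :=
  ∑' k : ℕ, ((seriesCoeff p b k * shiftProd p y k : ℝ) : ℂ) * μ ^ k

variable {p b : ℝ}

lemma qPochhammer_pos (hp0 : 0 < p) (hp1 : p < 1) (hb0 : 0 < b) (hb1 : b < 1) (k : ℕ) :
    0 < qPochhammer b p k := by
  refine Finset.prod_pos fun i _ => ?_
  have h1 : p ^ i ≤ 1 := pow_le_one₀ hp0.le hp1.le
  have h2 : 0 < p ^ i := pow_pos hp0 i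
  nlinarith

lemma qPochhammer_succ (k : ℕ) :
    qPochhammer b p (k + 1) = qPochhammer b p k * (1 - b * p ^ k) :=
  Finset.prod_range_succ _ _

lemma qPochhammer_succ' (k : ℕ) :
    qPochhammer b p (k + 1) = (1 - b) * qPochhammer (b * p) p k := by
  rw [qPochhammer, Finset.prod_range_succ', mul_comm, pow_zero, mul_one, qPochhammer]
  congr 1
  refine Finset.prod_congr rfl fun i _ => ?_
  rw [pow_succ']
  ring

lemma one_sub_mul_pow_pos (hp0 : 0 < p) (hp1 : p < 1) (hb1 : b < 1) (k : ℕ) :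
    0 < 1 - b * p ^ k := by
  have h1 : p ^ k ≤ 1 := pow_le_one₀ hp0.le hp1.le
  have h2 : 0 < p ^ k := pow_pos hp0 k
  nlinarith

lemma seriesCoeff_ne_zero (hp0 : 0 < p) (hp1 : p < 1) (hb0 : 0 < b) (hb1 : b < 1) (k : ℕ) :
    seriesCoeff p b k ≠ 0 := by
  have h1 := qPochhammer_pos hp0 hp1 hp0 hp1 k
  have h2 := qPochhammer_pos hp0 hp1 hb0 hb1 k
  unfold seriesCoeff
  have : ((-1 : ℝ)) ^ k ≠ 0 := pow_ne_zero _ (by norm_num)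
  positivity

lemma seriesCoeff_succ (hp0 : 0 < p) (hp1 : p < 1) (hb0 : 0 < b) (hb1 : b < 1) (k : ℕ) :
    seriesCoeff p b (k + 1) =
      seriesCoeff p b k * (-(p ^ k * b) / ((1 - p * p ^ k) * (1 - b * p ^ k))) := by
  have h1 := (qPochhammer_pos hp0 hp1 hp0 hp1 k).ne'
  have h2 := (qPochhammer_pos hp0 hp1 hb0 hb1 k).ne'
  have h3 := (one_sub_mul_pow_pos hp0 hp1 hp1 k).ne'
  have h4 := (one_sub_mul_pow_pos hp0 hp1 hb1 k).ne'
  simp only [seriesCoeff, qPochhammer_succ, Nat.choose_succ_succ' k 1, Nat.choose_one_right]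
  field_simp
  ring

lemma summable_seriesCoeff (hp0 : 0 < p) (hp1 : p < 1) (hb0 : 0 < b) (hb1 : b < 1) {R : ℝ}
    (hR : 0 < R) : Summable fun k => |seriesCoeff p b k| * R ^ k := by
  refine summable_of_ratio_test_tendsto_lt_one (l := 0) one_pos
    (Eventually.of_forall fun k => ?_) ?_
  · exact mul_ne_zero (abs_ne_zero.2 (seriesCoeff_ne_zero hp0 hp1 hb0 hb1 k)) (pow_pos hR k).ne'
  · have hpow := tendsto_pow_atTop_nhds_zero_of_lt_one hp0.le hp1
    have h1 : Tendsto (fun k : ℕ => |-(p ^ k * b) / ((1 - p * p ^ k) * (1 - b * p ^ k))| * R) atTop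
        (𝓝 (|-(0 * b) / ((1 - p * 0) * (1 - b * 0))| * R)) := by
      refine Tendsto.mul_const _ (Tendsto.abs (Tendsto.div ((hpow.mul_const b).neg) ?_ (by simp)))
      exact ((hpow.const_mul p).const_sub 1).mul ((hpow.const_mul b).const_sub 1)
    have h0 : |-(0 * b) / ((1 - p * 0) * (1 - b * 0))| * R = 0 := by simp
    rw [h0] at h1
    refine h1.congr fun k => ?_
    have h2 := seriesCoeff_ne_zero hp0 hp1 hb0 hb1 k
    have h3 : |seriesCoeff p b k| ≠ 0 := abs_ne_zero.2 h2
    have h4 := (pow_pos hR k).ne'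
    rw [seriesCoeff_succ hp0 hp1 hb0 hb1, norm_mul, norm_mul, norm_pow, norm_pow, Real.norm_eq_abs,
      Real.norm_eq_abs, Real.norm_eq_abs, abs_abs, abs_abs, abs_mul, abs_of_pos hR, pow_succ]
    field_simp

lemma abs_shiftProd_le (hp0 : 0 < p) (hp1 : p < 1) {y : ℝ} (hy : |y| ≤ 1) (k : ℕ) :
    |shiftProd p y k| ≤ 2 ^ k := by
  rw [shiftProd, Finset.abs_prod]
  calc _ ≤ ∏ _i ∈ Finset.range k, (2 : ℝ) := by
        refine Finset.prod_le_prod (fun _ _ => abs_nonneg _) fun i _ => ?_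
        refine (abs_add_le _ _).trans ?_
        have h1 : |p ^ i| ≤ 1 := by
          rw [abs_of_pos (pow_pos hp0 i)]
          exact pow_le_one₀ hp0.le hp1.le
        linarith
    _ = 2 ^ k := by simp

lemma norm_term_le (hp0 : 0 < p) (hp1 : p < 1) {y : ℝ} (hy : |y| ≤ 1) {μ : ℂ} {R : ℝ}
    (hμ : ‖μ‖ ≤ R) (k : ℕ) :
    ‖((seriesCoeff p b k * shiftProd p y k : ℝ) : ℂ) * μ ^ k‖ ≤
      |seriesCoeff p b k| * (2 * R) ^ k := by
  rw [norm_mul, norm_pow, Complex.norm_real, Real.norm_eq_abs, abs_mul, mul_pow, ← mul_assoc]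
  gcongr
  exact abs_shiftProd_le hp0 hp1 hy k

lemma hasSum_besselSeries (hp0 : 0 < p) (hp1 : p < 1) (hb0 : 0 < b) (hb1 : b < 1) {y : ℝ}
    (hy : |y| ≤ 1) (μ : ℂ) :
    HasSum (fun k => ((seriesCoeff p b k * shiftProd p y k : ℝ) : ℂ) * μ ^ k)
      (besselSeries p b y μ) := by
  have hR : 0 < ‖μ‖ + 1 := by positivity
  exact (Summable.of_norm_bounded (summable_seriesCoeff hp0 hp1 hb0 hb1 (mul_pos two_pos hR))
    fun k => norm_term_le hp0 hp1 hy (by linarith) k).hasSum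

/-- A bound for the Bessel series that is uniform in `|y| ≤ 1`. -/
lemma exists_bound_besselSeries (hp0 : 0 < p) (hp1 : p < 1) (hb0 : 0 < b) (hb1 : b < 1) (μ : ℂ) :
    ∃ C : ℝ, ∀ y : ℝ, |y| ≤ 1 → ‖besselSeries p b y μ‖ ≤ C := by
  have hR : 0 < ‖μ‖ + 1 := by positivity
  have hs := summable_seriesCoeff hp0 hp1 hb0 hb1 (mul_pos two_pos hR)
  exact ⟨_, fun y hy => tsum_of_norm_bounded hs.hasSum
    fun k => norm_term_le hp0 hp1 hy (by linarith) k⟩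

lemma continuousOn_besselSeries (hp0 : 0 < p) (hp1 : p < 1) (hb0 : 0 < b) (hb1 : b < 1) (μ : ℂ) :
    ContinuousOn (fun y => besselSeries p b y μ) {y | |y| ≤ 1} := by
  have hR : 0 < ‖μ‖ + 1 := by positivity
  refine continuousOn_tsum (fun k => ?_) (summable_seriesCoeff hp0 hp1 hb0 hb1 (mul_pos two_pos hR))
    fun k y hy => norm_term_le hp0 hp1 hy (by linarith) k
  unfold shiftProd
  fun_prop

lemma tendsto_besselSeries (hp0 : 0 < p) (hp1 : p < 1) (hb0 : 0 < b) (hb1 : b < 1) (μ : ℂ)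
    {z : ℕ → ℝ} (hz : ∀ n, |z n| ≤ 1) (hlim : Tendsto z atTop (𝓝 0)) :
    Tendsto (fun n => besselSeries p b (z n) μ) atTop (𝓝 (besselSeries p b 0 μ)) := by
  have h0 : (0 : ℝ) ∈ {y : ℝ | |y| ≤ 1} := by simp
  exact ((continuousOn_besselSeries hp0 hp1 hb0 hb1 μ) 0 h0).tendsto.comp
    (tendsto_nhdsWithin_iff.2 ⟨hlim, Eventually.of_forall hz⟩)

lemma differentiable_besselSeries (hp0 : 0 < p) (hp1 : p < 1) (hb0 : 0 < b) (hb1 : b < 1) {y : ℝ}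
    (hy : |y| ≤ 1) : Differentiable ℂ (besselSeries p b y) := by
  intro μ
  have hR : 0 < ‖μ‖ + 1 := by positivity
  have h1 : DifferentiableOn ℂ (besselSeries p b y) (Metric.ball 0 (‖μ‖ + 1)) :=
    Complex.differentiableOn_tsum_of_summable_norm
      (summable_seriesCoeff hp0 hp1 hb0 hb1 (mul_pos two_pos hR))
      (fun k => by fun_prop) Metric.isOpen_ball
      fun k w hw => norm_term_le hp0 hp1 hy (by simpa using (mem_ball_zero_iff.1 hw).le) k
  exact h1.differentiableAt (Metric.isOpen_ball.mem_nhds (by simp))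

lemma besselSeries_at_zero (y : ℝ) : besselSeries p b y 0 = 1 := by
  rw [besselSeries, tsum_eq_single 0 fun k hk => by rw [zero_pow hk, mul_zero]]
  simp [seriesCoeff, shiftProd, qPochhammer]

lemma besselSeries_neg_one (μ : ℂ) : besselSeries p b (-1) μ = 1 := by
  rw [besselSeries, tsum_eq_single 0 fun k hk => ?_]
  · simp [seriesCoeff, shiftProd, qPochhammer]
  · have h1 : shiftProd p (-1) k = 0 :=
      Finset.prod_eq_zero (Finset.mem_range.2 (Nat.pos_of_ne_zero hk)) (by simp)
    simp [h1]

lemma shiftProd_succ (y : ℝ) (k : ℕ) :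
    shiftProd p y (k + 1) = shiftProd p y k * (y + p ^ k) :=
  Finset.prod_range_succ _ _

lemma shiftProd_mul_succ (y : ℝ) (k : ℕ) :
    shiftProd p (p * y) (k + 1) = (1 + p * y) * (p ^ k * shiftProd p y k) := by
  have h1 : ∀ i, p * y + p ^ (i + 1) = p * (y + p ^ i) := fun i => by ring
  rw [shiftProd, Finset.prod_range_succ', pow_zero, mul_comm, add_comm (p * y) 1]
  simp only [h1, Finset.prod_mul_distrib, Finset.prod_const, Finset.card_range, shiftProd]

/-- The first `q`-difference relation: differencing in `y` shifts the parameter `b` to `b p`. -/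
lemma besselSeries_sub (hp0 : 0 < p) (hp1 : p < 1) (hb0 : 0 < b) (hb1 : b < 1) {y : ℝ}
    (hy : |y| ≤ 1) (μ : ℂ) :
    besselSeries p b y μ - besselSeries p b (p * y) μ =
      -((b / (1 - b) : ℝ) : ℂ) * μ * y * besselSeries p (b * p) y μ := by
  have hpy : |p * y| ≤ 1 := by
    rw [abs_mul, abs_of_pos hp0]
    nlinarith [abs_nonneg y]
  have hbp0 : 0 < b * p := mul_pos hb0 hp0
  have hbp1 : b * p < 1 := by nlinarith
  have h1 := (hasSum_besselSeries hp0 hp1 hb0 hb1 hy μ).sub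
    (hasSum_besselSeries hp0 hp1 hb0 hb1 hpy μ)
  rw [← hasSum_nat_add_iff' 1] at h1
  have h2 := (hasSum_besselSeries hp0 hp1 hbp0 hbp1 hy μ).mul_left
    (-((b / (1 - b) : ℝ) : ℂ) * μ * y)
  have h3 := h1.unique (h2.congr_fun fun k => ?_)
  · simpa [shiftProd] using h3
  · have hco : seriesCoeff p b (k + 1) * (1 - p * p ^ k) =
        -(b / (1 - b)) * seriesCoeff p (b * p) k := by
      have e1 := (qPochhammer_pos hp0 hp1 hp0 hp1 k).ne'
      have e2 := (qPochhammer_pos hp0 hp1 hbp0 hbp1 k).ne'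
      have e3 := (one_sub_mul_pow_pos hp0 hp1 hp1 k).ne'
      have e4 : 1 - b ≠ 0 := by linarith
      simp only [seriesCoeff, qPochhammer_succ' (b := b), qPochhammer_succ (b := p),
        Nat.choose_succ_succ' k 1, Nat.choose_one_right]
      field_simp
      ring
    have hsh : shiftProd p y (k + 1) - shiftProd p (p * y) (k + 1) =
        shiftProd p y k * y * (1 - p * p ^ k) := by
      have hmul := shiftProd_mul_succ (p := p) y k
      rw [hmul, shiftProd_succ]
      ring
    have hre : seriesCoeff p b (k + 1) * shiftProd p y (k + 1) -
        seriesCoeff p b (k + 1) * shiftProd p (p * y) (k + 1) =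
        -(b / (1 - b)) * y * (seriesCoeff p (b * p) k * shiftProd p y k) := by
      linear_combination seriesCoeff p b (k + 1) * hsh + shiftProd p y k * y * hco
    have hre' := congrArg (fun r : ℝ => (r : ℂ)) hre
    push_cast at hre' ⊢
    rw [pow_succ]
    linear_combination μ ^ k * μ * hre'

/-- The second `q`-difference relation, adjoint to the first with respect to the weight. -/
lemma besselSeries_sub_weighted (hp0 : 0 < p) (hp1 : p < 1) (hb0 : 0 < b) (hb1 : b < 1) {y : ℝ}
    (hy : |y| ≤ 1) (μ : ℂ) :
    (1 + p * y : ℝ) * besselSeries p (b * p) y μ -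
        (1 + b * (p * y) : ℝ) * besselSeries p (b * p) (p * y) μ =
      ((1 - b) * (p * y) : ℝ) * besselSeries p b (p * y) μ := by
  have hpy : |p * y| ≤ 1 := by
    rw [abs_mul, abs_of_pos hp0]
    nlinarith [abs_nonneg y]
  have hbp0 : 0 < b * p := mul_pos hb0 hp0
  have hbp1 : b * p < 1 := by nlinarith
  have h1 := ((hasSum_besselSeries hp0 hp1 hbp0 hbp1 hy μ).mul_left
    ((1 + p * y : ℝ) : ℂ)).sub ((hasSum_besselSeries hp0 hp1 hbp0 hbp1 hpy μ).mul_left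
    ((1 + b * (p * y) : ℝ) : ℂ))
  have h2 := (hasSum_besselSeries hp0 hp1 hb0 hb1 hpy μ).mul_left (((1 - b) * (p * y) : ℝ) : ℂ)
  refine h1.unique (h2.congr_fun fun k => ?_)
  have hco : seriesCoeff p (b * p) k * (1 - b * p ^ k) = p ^ k * seriesCoeff p b k * (1 - b) := by
    have e1 := (qPochhammer_pos hp0 hp1 hp0 hp1 k).ne'
    have e2 := (qPochhammer_pos hp0 hp1 hbp0 hbp1 k).ne'
    have e3 := (one_sub_mul_pow_pos hp0 hp1 hb1 k).ne'
    have e4 : 1 - b ≠ 0 := by linarith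
    have e5 : qPochhammer b p k = (1 - b) * qPochhammer (b * p) p k / (1 - b * p ^ k) := by
      rw [eq_div_iff e3, ← qPochhammer_succ, qPochhammer_succ']
    simp only [seriesCoeff, e5]
    field_simp
    ring
  have hsh : (1 + p * y) * (p ^ k * shiftProd p y k) = shiftProd p (p * y) k * (p * y + p ^ k) := by
    rw [← shiftProd_mul_succ, shiftProd_succ]
  have hpk : p ^ k ≠ 0 := (pow_pos hp0 k).ne'
  have hre : (1 + p * y) * (seriesCoeff p (b * p) k * shiftProd p y k) -
      (1 + b * (p * y)) * (seriesCoeff p (b * p) k * shiftProd p (p * y) k) =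
      (1 - b) * (p * y) * (seriesCoeff p b k * shiftProd p (p * y) k) := by
    refine mul_left_cancel₀ hpk ?_
    linear_combination seriesCoeff p (b * p) k * hsh + shiftProd p (p * y) k * (p * y) * hco
  have hre' := congrArg (fun r : ℝ => (r : ℂ)) hre
  push_cast at hre' ⊢
  linear_combination μ ^ k * hre'

end Series

end BigQBessel

/-! ### Weights and summation over the two-sided grid -/

namespace BigQBessel

section InfiniteProduct

variable {p : ℝ}

lemma summable_norm_mul_pow (hp0 : 0 < p) (hp1 : p < 1) (a : ℝ) :
    Summable fun i : ℕ => ‖-(a * p ^ i)‖ := by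
  simpa [abs_mul, abs_of_pos hp0] using
    (summable_geometric_of_lt_one hp0.le hp1).mul_left |a|

lemma multipliable_qPochhammerInf (hp0 : 0 < p) (hp1 : p < 1) (a : ℝ) :
    Multipliable fun i : ℕ => 1 - a * p ^ i := by
  simpa [sub_eq_add_neg] using
    multipliable_one_add_of_summable (summable_norm_mul_pow hp0 hp1 a)

lemma tendsto_qPochhammer (hp0 : 0 < p) (hp1 : p < 1) (a : ℝ) :
    Tendsto (qPochhammer a p) atTop (𝓝 (qPochhammerInf a p)) :=
  (multipliable_qPochhammerInf hp0 hp1 a).hasProd.tendsto_prod_nat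

lemma qPochhammerInf_pos (hp0 : 0 < p) (hp1 : p < 1) {a : ℝ} (ha : a < 1) :
    0 < qPochhammerInf a p := by
  have hpos : ∀ i : ℕ, 0 < 1 - a * p ^ i := fun i => one_sub_mul_pow_pos hp0 hp1 ha i
  have h1 : qPochhammerInf a p ≠ 0 := by
    have h2 := tprod_one_add_ne_zero_of_summable (f := fun i : ℕ => -(a * p ^ i))
      (fun i => by simpa [sub_eq_add_neg] using (hpos i).ne') (summable_norm_mul_pow hp0 hp1 a)
    simpa [qPochhammerInf, sub_eq_add_neg] using h2
  refine lt_of_le_of_ne (ge_of_tendsto' (tendsto_qPochhammer hp0 hp1 a) fun n => ?_) h1.symm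
  exact Finset.prod_nonneg fun i _ => (hpos i).le

lemma qPochhammer_mul_qPochhammerInf (hp0 : 0 < p) (hp1 : p < 1) (a : ℝ) (n : ℕ) :
    qPochhammer a p n * qPochhammerInf (a * p ^ n) p = qPochhammerInf a p := by
  refine tendsto_nhds_unique ((tendsto_qPochhammer hp0 hp1 (a * p ^ n)).const_mul
    (qPochhammer a p n)) (((tendsto_add_atTop_iff_nat n).2
      (tendsto_qPochhammer hp0 hp1 a)).congr fun m => ?_)
  rw [qPochhammer, add_comm, Finset.prod_range_add, qPochhammer, qPochhammer]
  congr 1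
  refine Finset.prod_congr rfl fun i _ => ?_
  rw [pow_add]
  ring

lemma one_sub_mul_qPochhammerInf (hp0 : 0 < p) (hp1 : p < 1) (a : ℝ) :
    (1 - a) * qPochhammerInf (a * p) p = qPochhammerInf a p := by
  simpa [qPochhammer] using qPochhammer_mul_qPochhammerInf hp0 hp1 a 1

lemma tendsto_qPochhammerInf_mul_pow (hp0 : 0 < p) (hp1 : p < 1) {a : ℝ} (ha : a < 1) :
    Tendsto (fun n : ℕ => qPochhammerInf (a * p ^ n) p) atTop (𝓝 1) := by
  have h0 := (qPochhammerInf_pos hp0 hp1 ha).ne'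
  have h1 := (tendsto_const_nhds (x := qPochhammerInf a p)).div (tendsto_qPochhammer hp0 hp1 a) h0
  rw [div_self h0] at h1
  refine h1.congr fun n => ?_
  have hn : qPochhammer a p n ≠ 0 := by
    refine Finset.prod_ne_zero_iff.2 fun i _ => (one_sub_mul_pow_pos hp0 hp1 ha i).ne'
  rw [Pi.div_apply, div_eq_iff hn, mul_comm, qPochhammer_mul_qPochhammerInf hp0 hp1]

end InfiniteProduct

section Weights

variable {p b : ℝ}

/-- The ratio `v(y) = (-y p; p)_∞ / (-y b p; p)_∞`, so that `weight q α x = x v(x²)`. -/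
noncomputable def weightRatio (p b y : ℝ) : ℝ :=
  qPochhammerInf (-(y * p)) p / qPochhammerInf (-(y * (b * p))) p

lemma neg_mul_lt_one {y d : ℝ} (hd0 : 0 < d) (hd1 : d < 1) (hy : |y| ≤ 1) : -(y * d) < 1 := by
  have := (abs_le.1 hy).1
  nlinarith

lemma weightRatio_pos (hp0 : 0 < p) (hp1 : p < 1) (hb0 : 0 < b) (hb1 : b < 1) {y : ℝ}
    (hy : |y| ≤ 1) : 0 < weightRatio p b y :=
  div_pos (qPochhammerInf_pos hp0 hp1 (neg_mul_lt_one hp0 hp1 hy))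
    (qPochhammerInf_pos hp0 hp1 (neg_mul_lt_one (mul_pos hb0 hp0) (by nlinarith) hy))

lemma one_add_mul_pos (hb0 : 0 < b) (hb1 : b < 1) {y : ℝ} (hy : |y| ≤ 1) : 0 < 1 + b * y := by
  have := (abs_le.1 hy).1
  nlinarith

lemma abs_mul_le_one (hp0 : 0 < p) (hp1 : p < 1) {y : ℝ} (hy : |y| ≤ 1) : |p * y| ≤ 1 := by
  rw [abs_mul, abs_of_pos hp0]
  nlinarith [abs_nonneg y]

lemma weightRatio_mul (hp0 : 0 < p) (hp1 : p < 1) (hb0 : 0 < b) (hb1 : b < 1) {y : ℝ}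
    (hy : |y| ≤ 1) :
    weightRatio p b y * (1 + b * (p * y)) = weightRatio p b (p * y) * (1 + p * y) := by
  have hbp0 : 0 < b * p := mul_pos hb0 hp0
  have hbp1 : b * p < 1 := by nlinarith
  have h1 := one_sub_mul_qPochhammerInf hp0 hp1 (-(y * p))
  have h2 := one_sub_mul_qPochhammerInf hp0 hp1 (-(y * (b * p)))
  have h3 := (qPochhammerInf_pos hp0 hp1 (neg_mul_lt_one hbp0 hbp1 (abs_mul_le_one hp0 hp1 hy))).ne'
  have h4 : 1 + b * (p * y) ≠ 0 := (one_add_mul_pos hb0 hb1 (abs_mul_le_one hp0 hp1 hy)).ne'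
  have e1 : -(y * p) * p = -(p * y * p) := by ring
  have e2 : -(y * (b * p)) * p = -(p * y * (b * p)) := by ring
  have e3 : 1 - -(y * (b * p)) = 1 + b * (p * y) := by ring
  rw [e1] at h1
  rw [e2, e3] at h2
  rw [weightRatio, weightRatio, ← h1, ← h2, div_mul_eq_mul_div, div_mul_eq_mul_div,
    div_eq_div_iff (mul_ne_zero h4 h3) h3]
  ring

lemma tendsto_weightRatio (hp0 : 0 < p) (hp1 : p < 1) (hb0 : 0 < b) (hb1 : b < 1) {y : ℝ}
    (hy : |y| ≤ 1) : Tendsto (fun n : ℕ => weightRatio p b (y * p ^ n)) atTop (𝓝 1) := by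
  have hbp0 : 0 < b * p := mul_pos hb0 hp0
  have hbp1 : b * p < 1 := by nlinarith
  have h1 := (tendsto_qPochhammerInf_mul_pow hp0 hp1 (neg_mul_lt_one hp0 hp1 hy)).div
    (tendsto_qPochhammerInf_mul_pow hp0 hp1 (neg_mul_lt_one hbp0 hbp1 hy)) one_ne_zero
  rw [div_one] at h1
  refine h1.congr fun n => ?_
  rw [Pi.div_apply, weightRatio]
  congr 2 <;> ring

/-- The two-sided grid `{p^n} ∪ {-p^n}`, `n ≥ 0`, on which the Bessel series are orthogonal. -/
noncomputable def grid (p : ℝ) : ℕ ⊕ ℕ → ℝ :=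
  Sum.elim (fun n => p ^ n) fun n => -p ^ n

lemma abs_grid_le_one (hp0 : 0 < p) (hp1 : p < 1) (s : ℕ ⊕ ℕ) : |grid p s| ≤ 1 := by
  rcases s with n | n <;>
  simpa [grid, abs_of_pos hp0] using pow_le_one₀ hp0.le hp1.le

lemma abs_grid_pos (hp0 : 0 < p) (s : ℕ ⊕ ℕ) : 0 < |grid p s| := by
  rcases s with n | n <;> simp [grid, abs_pos, hp0.ne']

lemma summable_abs_grid (hp0 : 0 < p) (hp1 : p < 1) : Summable fun s => |grid p s| := by
  have h1 := (summable_geometric_of_lt_one hp0.le hp1).hasSum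
  refine (HasSum.sum (f := fun s => |grid p s|) (h1.congr_fun fun n => ?_)
    (h1.congr_fun fun n => ?_)).summable <;>
  simp [grid, abs_of_pos hp0]

lemma exists_bound_weightRatio (hp0 : 0 < p) (hp1 : p < 1) (hb0 : 0 < b) (hb1 : b < 1) :
    ∃ C : ℝ, ∀ s, weightRatio p b (grid p s) ≤ C ∧ (weightRatio p b (grid p s))⁻¹ ≤ C := by
  have key : ∀ y : ℝ, |y| ≤ 1 → ∃ C : ℝ, ∀ n : ℕ, weightRatio p b (y * p ^ n) ≤ C ∧
      (weightRatio p b (y * p ^ n))⁻¹ ≤ C := by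
    intro y hy
    have h1 := tendsto_weightRatio hp0 hp1 hb0 hb1 hy
    obtain ⟨C1, h2⟩ := h1.bddAbove_range
    obtain ⟨C2, h3⟩ := (h1.inv₀ one_ne_zero).bddAbove_range
    exact ⟨max C1 C2, fun n => ⟨(h2 ⟨n, rfl⟩).trans (le_max_left _ _),
      (h3 ⟨n, rfl⟩).trans (le_max_right _ _)⟩⟩
  obtain ⟨C1, h1⟩ := key 1 (by simp)
  obtain ⟨C2, h2⟩ := key (-1) (by simp)
  refine ⟨max C1 C2, ?_⟩
  rintro (n | n)
  · have := h1 n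
    simp only [one_mul] at this
    exact ⟨this.1.trans (le_max_left _ _), this.2.trans (le_max_left _ _)⟩
  · have := h2 n
    simp only [neg_mul, one_mul] at this
    exact ⟨this.1.trans (le_max_right _ _), this.2.trans (le_max_right _ _)⟩

/-- The weight `|y| v(y) / (1 + b y)` dual to `|y| v(y)` on the grid. -/
noncomputable def dualWeight (p b : ℝ) (t : ℕ ⊕ ℕ) : ℝ :=
  |grid p t| * weightRatio p b (grid p t) / (1 + b * grid p t)

lemma dualWeight_pos (hp0 : 0 < p) (hp1 : p < 1) (hb0 : 0 < b) (hb1 : b < 1) (t : ℕ ⊕ ℕ) :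
    0 < dualWeight p b t :=
  div_pos (mul_pos (abs_grid_pos hp0 t)
    (weightRatio_pos hp0 hp1 hb0 hb1 (abs_grid_le_one hp0 hp1 t)))
    (one_add_mul_pos hb0 hb1 (abs_grid_le_one hp0 hp1 t))

lemma summable_dualWeight (hp0 : 0 < p) (hp1 : p < 1) (hb0 : 0 < b) (hb1 : b < 1) :
    Summable (dualWeight p b) := by
  obtain ⟨C, hC⟩ := exists_bound_weightRatio hp0 hp1 hb0 hb1
  refine Summable.of_nonneg_of_le (fun t => (dualWeight_pos hp0 hp1 hb0 hb1 t).le) (fun t => ?_)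
    ((summable_abs_grid hp0 hp1).mul_right (C / (1 - b)))
  have h1 := (abs_le.1 (abs_grid_le_one hp0 hp1 t)).1
  have h2 : 1 - b ≤ 1 + b * grid p t := by nlinarith
  have h3 : 0 < 1 - b := by linarith
  have h4 := (weightRatio_pos hp0 hp1 hb0 hb1 (abs_grid_le_one hp0 hp1 t)).le
  have h5 := (hC t).1
  have h6 : 0 ≤ C := h4.trans h5
  rw [dualWeight, mul_div_assoc]
  gcongr

end Weights

section Telescoping

lemma hasSum_telescope_lt (g : ℕ → ℂ) (n : ℕ) :
    HasSum (fun m => if m < n then g (m + 1) - g m else 0) (g n - g 0) := by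
  rw [← Finset.sum_range_sub g n]
  have h1 : ∀ m ∈ Finset.range n, g (m + 1) - g m = if m < n then g (m + 1) - g m else 0 :=
    fun m hm => (if_pos (Finset.mem_range.1 hm)).symm
  rw [Finset.sum_congr rfl h1]
  exact hasSum_sum_of_ne_finset_zero fun m hm => if_neg fun h => hm (Finset.mem_range.2 h)

lemma hasSum_telescope {g : ℕ → ℂ} {L : ℂ} (hL : Tendsto g atTop (𝓝 L))
    (hs : Summable fun m => g (m + 1) - g m) : HasSum (fun m => g (m + 1) - g m) (L - g 0) := by
  rw [hs.hasSum_iff_tendsto_nat]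
  simp only [Finset.sum_range_sub]
  exact hL.sub_const _

lemma hasSum_telescope_ge {g : ℕ → ℂ} {L : ℂ} (hL : Tendsto g atTop (𝓝 L))
    (hs : Summable fun m => g (m + 1) - g m) (n : ℕ) :
    HasSum (fun m => if n ≤ m then g (m + 1) - g m else 0) (L - g n) := by
  have h1 := (hasSum_telescope hL hs).sub (hasSum_telescope_lt g n)
  rw [sub_sub_sub_cancel_right] at h1
  refine h1.congr_fun fun m => ?_
  rcases lt_or_ge m n with h | h
  · simp [h, not_le.2 h]
  · simp [h, not_lt.2 h]

end Telescoping

section Volterra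

variable {p b : ℝ}

/-- The indicator that the grid point `s` lies to the right of the grid point `t`, where for
negative points equality is allowed. -/
def rightOf : ℕ ⊕ ℕ → ℕ ⊕ ℕ → ℝ
  | .inl n, .inl m => if m < n then 1 else 0
  | .inl _, .inr _ => 0
  | .inr _, .inl _ => 1
  | .inr n, .inr m => if n ≤ m then 1 else 0

lemma rightOf_nonneg (t s : ℕ ⊕ ℕ) : 0 ≤ rightOf t s := by
  rcases t with n | n <;> rcases s with m | m <;> simp only [rightOf] <;>
    positivity

lemma rightOf_le_one (t s : ℕ ⊕ ℕ) : rightOf t s ≤ 1 := by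
  rcases t with n | n <;> rcases s with m | m <;> simp only [rightOf] <;>
    (try split_ifs) <;> norm_num

lemma summable_of_bound_mul_pow (hp0 : 0 < p) (hp1 : p < 1) {d : ℕ → ℂ} {C : ℝ}
    (hd : ∀ n, ‖d n‖ ≤ C * p ^ n) : Summable d :=
  Summable.of_norm_bounded ((summable_geometric_of_lt_one hp0.le hp1).mul_left C) hd

lemma tendsto_mul_pow_zero (hp0 : 0 < p) (hp1 : p < 1) (y : ℝ) :
    Tendsto (fun n : ℕ => y * p ^ n) atTop (𝓝 0) := by
  simpa using (tendsto_pow_atTop_nhds_zero_of_lt_one hp0.le hp1).const_mul y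

lemma abs_mul_pow_le_one (hp0 : 0 < p) (hp1 : p < 1) {y : ℝ} (hy : |y| ≤ 1) (n : ℕ) :
    |y * p ^ n| ≤ 1 := by
  rw [abs_mul, abs_of_pos (pow_pos hp0 n)]
  exact mul_le_one₀ hy (pow_pos hp0 n).le (pow_le_one₀ hp0.le hp1.le)

lemma besselSeries_telescope (hp0 : 0 < p) (hp1 : p < 1) (hb0 : 0 < b) (hb1 : b < 1) {y : ℝ}
    (hy : |y| ≤ 1) (μ : ℂ) (m : ℕ) :
    besselSeries p b (y * p ^ (m + 1)) μ - besselSeries p b (y * p ^ m) μ =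
      ((b / (1 - b) : ℝ) : ℂ) * μ * (y * p ^ m : ℝ) * besselSeries p (b * p) (y * p ^ m) μ := by
  have h1 := besselSeries_sub hp0 hp1 hb0 hb1 (abs_mul_pow_le_one hp0 hp1 hy m) μ
  have e : p * (y * p ^ m) = y * p ^ (m + 1) := by ring
  rw [e] at h1
  linear_combination -h1

lemma summable_besselSeries_telescope (hp0 : 0 < p) (hp1 : p < 1) (hb0 : 0 < b) (hb1 : b < 1)
    {y : ℝ} (hy : |y| ≤ 1) (μ : ℂ) :
    Summable fun m : ℕ =>
      besselSeries p b (y * p ^ (m + 1)) μ - besselSeries p b (y * p ^ m) μ := by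
  have hbp0 : 0 < b * p := mul_pos hb0 hp0
  have hbp1 : b * p < 1 := by nlinarith
  obtain ⟨C, hC⟩ := exists_bound_besselSeries hp0 hp1 hbp0 hbp1 μ
  have hC0 : 0 ≤ C := (norm_nonneg _).trans (hC 0 (by simp))
  refine summable_of_bound_mul_pow hp0 hp1
    (C := ‖((b / (1 - b) : ℝ) : ℂ) * μ‖ * C) fun m => ?_
  rw [besselSeries_telescope hp0 hp1 hb0 hb1 hy, norm_mul, norm_mul, Complex.norm_real,
    Real.norm_eq_abs, abs_mul, abs_of_pos (pow_pos hp0 m)]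
  have h1 := hC _ (abs_mul_pow_le_one hp0 hp1 hy m)
  have h2 := pow_pos hp0 m
  calc _ ≤ ‖((b / (1 - b) : ℝ) : ℂ) * μ‖ * (1 * p ^ m) * C := by gcongr
    _ = _ := by ring

/-- The Bessel series with parameter `b` at a grid point `t` is its value at `y = 1` plus the
sum of the one with parameter `b p` over the points to the right of `t`. -/
lemma hasSum_rightOf_left (hp0 : 0 < p) (hp1 : p < 1) (hb0 : 0 < b) (hb1 : b < 1) (μ : ℂ)
    (t : ℕ ⊕ ℕ) :
    HasSum (fun s => (rightOf t s : ℂ) * (((b / (1 - b) : ℝ) : ℂ) * μ * (|grid p s| : ℝ) *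
      besselSeries p (b * p) (grid p s) μ))
      (besselSeries p b (grid p t) μ - besselSeries p b 1 μ) := by
  have h1 : |(1 : ℝ)| ≤ 1 := by simp
  have h2 : |(-1 : ℝ)| ≤ 1 := by simp
  have hlim : ∀ y : ℝ, |y| ≤ 1 → Tendsto (fun n : ℕ => besselSeries p b (y * p ^ n) μ) atTop
      (𝓝 (besselSeries p b 0 μ)) := fun y hy =>
    tendsto_besselSeries hp0 hp1 hb0 hb1 μ (abs_mul_pow_le_one hp0 hp1 hy)
      (tendsto_mul_pow_zero hp0 hp1 y)
  rcases t with n | n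
  · have hA := hasSum_telescope_lt (fun m => besselSeries p b (1 * p ^ m) μ) n
    simp only [besselSeries_telescope hp0 hp1 hb0 hb1 h1] at hA
    simp only [one_mul, pow_zero] at hA
    rw [← add_zero (besselSeries p b (grid p (Sum.inl n)) μ - _)]
    refine HasSum.sum (hA.congr_fun fun m => ?_) (hasSum_zero.congr_fun fun m => ?_)
    · by_cases hm : m < n <;> simp [rightOf, grid, abs_of_pos hp0, hm]
    · simp [rightOf]
  · have hA := hasSum_telescope (hlim 1 h1) (summable_besselSeries_telescope hp0 hp1 hb0 hb1 h1 μ)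
    have hB := (hasSum_telescope_ge (hlim (-1) h2)
      (summable_besselSeries_telescope hp0 hp1 hb0 hb1 h2 μ) n).neg
    simp only [besselSeries_telescope hp0 hp1 hb0 hb1 h1] at hA
    simp only [one_mul, pow_zero] at hA
    simp only [besselSeries_telescope hp0 hp1 hb0 hb1 h2] at hB
    simp only [neg_mul, one_mul] at hB
    have e : besselSeries p b (grid p (Sum.inr n)) μ - besselSeries p b 1 μ =
        (besselSeries p b 0 μ - besselSeries p b 1 μ) +
          -(besselSeries p b 0 μ - besselSeries p b (-p ^ n) μ) := by
      simp only [grid, Sum.elim_inr]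
      ring
    rw [e]
    refine HasSum.sum (hA.congr_fun fun m => ?_) (hB.congr_fun fun m => ?_)
    · simp [rightOf, grid, abs_of_pos hp0]
    · by_cases hm : n ≤ m <;> simp [rightOf, grid, abs_of_pos hp0, hm]

lemma weighted_telescope (hp0 : 0 < p) (hp1 : p < 1) (hb0 : 0 < b) (hb1 : b < 1) {y : ℝ}
    (hy : |y| ≤ 1) (μ : ℂ) (m : ℕ) :
    (weightRatio p b (y * p ^ (m + 1)) : ℂ) * besselSeries p (b * p) (y * p ^ (m + 1)) μ -
        (weightRatio p b (y * p ^ m) : ℂ) * besselSeries p (b * p) (y * p ^ m) μ =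
      -(((1 - b) * ((y * p ^ (m + 1)) * weightRatio p b (y * p ^ (m + 1)) /
        (1 + b * (y * p ^ (m + 1)))) : ℝ) : ℂ) * besselSeries p b (y * p ^ (m + 1)) μ := by
  have hm := abs_mul_pow_le_one hp0 hp1 hy m
  have h1 := besselSeries_sub_weighted hp0 hp1 hb0 hb1 hm μ
  have h2 := weightRatio_mul hp0 hp1 hb0 hb1 hm
  have e : p * (y * p ^ m) = y * p ^ (m + 1) := by ring
  rw [e] at h1 h2
  have h3 := (one_add_mul_pos hb0 hb1 (abs_mul_pow_le_one hp0 hp1 hy (m + 1))).ne'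
  have h2' := congrArg (fun r : ℝ => (r : ℂ)) h2
  have h3' : ((1 + b * (y * p ^ (m + 1)) : ℝ) : ℂ) ≠ 0 := by exact_mod_cast h3
  set z := y * p ^ (m + 1)
  set x := y * p ^ m
  push_cast at h1 h2' h3' ⊢
  field_simp
  linear_combination (-(weightRatio p b z : ℂ)) * h1 - besselSeries p (b * p) x μ * h2'

/-- The weighted Bessel series with parameter `b p` at a grid point `s` is the sum, with the dual
weight, of the one with parameter `b` over the points to the left of `s`. For `s > 0` the sum runs
through all negative points, and the two one-sided limits at `0` cancel. -/
lemma hasSum_rightOf_right (hp0 : 0 < p) (hp1 : p < 1) (hb0 : 0 < b) (hb1 : b < 1) (μ : ℂ)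
    (s : ℕ ⊕ ℕ) :
    HasSum (fun t => (rightOf t s : ℂ) * (((1 - b) * dualWeight p b t : ℝ) *
      besselSeries p b (grid p t) μ))
      (weightRatio p b (grid p s) * besselSeries p (b * p) (grid p s) μ) := by
  have hbp0 : 0 < b * p := mul_pos hb0 hp0
  have hbp1 : b * p < 1 := by nlinarith
  have h1 : |(1 : ℝ)| ≤ 1 := by simp
  have h2 : |(-1 : ℝ)| ≤ 1 := by simp
  set V : ℝ → ℂ := fun y => (weightRatio p b y : ℂ) * besselSeries p (b * p) y μ with hV
  have hlim : ∀ y : ℝ, |y| ≤ 1 → Tendsto (fun n : ℕ => V (y * p ^ n)) atTop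
      (𝓝 (besselSeries p (b * p) 0 μ)) := by
    intro y hy
    have h3 := tendsto_besselSeries hp0 hp1 hbp0 hbp1 μ (abs_mul_pow_le_one hp0 hp1 hy)
      (tendsto_mul_pow_zero hp0 hp1 y)
    have h4 := (Complex.continuous_ofReal.tendsto _).comp (tendsto_weightRatio hp0 hp1 hb0 hb1 hy)
    simpa using h4.mul h3
  have hsumm : Summable fun t => (((1 - b) * dualWeight p b t : ℝ) : ℂ) *
      besselSeries p b (grid p t) μ := by
    obtain ⟨C, hC⟩ := exists_bound_besselSeries hp0 hp1 hb0 hb1 μ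
    refine Summable.of_norm_bounded
      (((summable_dualWeight hp0 hp1 hb0 hb1).mul_left (1 - b)).mul_right C) fun t => ?_
    have h3 : 0 ≤ (1 - b) * dualWeight p b t :=
      mul_nonneg (by linarith) (dualWeight_pos hp0 hp1 hb0 hb1 t).le
    rw [norm_mul, Complex.norm_real, Real.norm_of_nonneg h3]
    gcongr
    exact hC _ (abs_grid_le_one hp0 hp1 t)
  -- on the negative side, the boundary term at `y = -1` is accounted for by a leading zero
  set g : ℕ → ℂ := fun n => Nat.casesOn n 0 fun m => V (-1 * p ^ m) with hg
  have hgd : ∀ n, g (n + 1) - g n = (((1 - b) * dualWeight p b (.inr n) : ℝ) : ℂ) *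
      besselSeries p b (grid p (.inr n)) μ := by
    rintro (_ | n)
    · have hb' : (1 : ℝ) - b ≠ 0 := by linarith
      have e : (1 - b) * dualWeight p b (Sum.inr 0) = weightRatio p b (-1) := by
        simp only [dualWeight, grid, Sum.elim_inr, pow_zero, abs_neg, abs_one]
        rw [mul_neg_one, ← sub_eq_add_neg]
        field_simp
      rw [e]
      simp [hg, hV, grid, besselSeries_neg_one]
    · have h3 := weighted_telescope hp0 hp1 hb0 hb1 h2 μ n
      simp only [hg, hV]
      rw [h3]
      simp [dualWeight, grid, abs_of_pos hp0]
      ring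
  have hglim : Tendsto g atTop (𝓝 (besselSeries p (b * p) 0 μ)) :=
    (tendsto_add_atTop_iff_nat 1).1 (hlim (-1) h2)
  rcases s with m | m
  · set k : ℕ → ℂ := fun n => V (1 * p ^ (n - 1)) with hk
    have hkd : ∀ n, m + 1 ≤ n → k (n + 1) - k n = -((((1 - b) * dualWeight p b (.inl n) : ℝ) : ℂ) *
        besselSeries p b (grid p (.inl n)) μ) := by
      intro n hn
      obtain ⟨j, rfl⟩ : ∃ j, n = j + 1 := ⟨n - 1, by omega⟩
      have h3 := weighted_telescope hp0 hp1 hb0 hb1 h1 μ j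
      simp only [hk, hV, Nat.add_sub_cancel]
      rw [h3]
      simp [dualWeight, grid, abs_of_pos hp0]
    have hklim : Tendsto k atTop (𝓝 (besselSeries p (b * p) 0 μ)) :=
      (tendsto_add_atTop_iff_nat 1).1 (hlim 1 h1)
    have hks : Summable fun n => k (n + 1) - k n := by
      rw [← summable_nat_add_iff (m + 1)]
      refine (((summable_nat_add_iff (m + 1)).2
        (hsumm.comp_injective Sum.inl_injective)).neg).congr fun n => ?_
      rw [hkd (n + (m + 1)) (by omega)]
      rfl
    have hA := (hasSum_telescope_ge hklim hks (m + 1)).neg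
    have hB := hasSum_telescope hglim ((hsumm.comp_injective Sum.inr_injective).congr
      fun n => (hgd n).symm)
    have e : (weightRatio p b (grid p (.inl m)) : ℂ) * besselSeries p (b * p) (grid p (.inl m)) μ =
        -(besselSeries p (b * p) 0 μ - k (m + 1)) + (besselSeries p (b * p) 0 μ - g 0) := by
      simp [hk, hV, hg, grid]
    rw [e]
    refine HasSum.sum (hA.congr_fun fun n => ?_) (hB.congr_fun fun n => ?_)
    · by_cases hn : m + 1 ≤ n
      · rw [if_pos hn, hkd n hn, neg_neg]
        simp [rightOf, Nat.lt_of_succ_le hn]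
      · have hn' : ¬ m < n := fun h => hn h
        simp [rightOf, hn, hn']
    · rw [hgd]
      simp [rightOf]
  · have hB := hasSum_telescope_lt g (m + 1)
    have e : (weightRatio p b (grid p (.inr m)) : ℂ) * besselSeries p (b * p) (grid p (.inr m)) μ =
        0 + (g (m + 1) - g 0) := by
      simp [hV, hg, grid]
    rw [e]
    refine HasSum.sum (hasSum_zero.congr_fun fun n => ?_) (hB.congr_fun fun n => ?_)
    · simp [rightOf]
    · rw [hgd]
      by_cases hn : n ≤ m
      · simp [rightOf, hn, Nat.lt_succ_of_le hn]
      · have hn' : ¬ n < m + 1 := by omega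
        simp [rightOf, hn, hn']

end Volterra

end BigQBessel

/-! ### The Hilbert space of the two-sided grid -/

namespace BigQBessel

section Moments

variable {p : ℝ}

lemma tendsto_pow_nhdsNE_zero (hp0 : 0 < p) (hp1 : p < 1) :
    Tendsto (fun k : ℕ => ((p : ℂ) ^ 2) ^ k) atTop (𝓝[≠] 0) := by
  refine tendsto_nhdsWithin_iff.2 ⟨tendsto_pow_atTop_nhds_zero_of_norm_lt_one ?_,
    Eventually.of_forall fun k => ?_⟩
  · rw [norm_pow, Complex.norm_real, Real.norm_of_nonneg hp0.le]
    exact pow_lt_one₀ hp0.le hp1 two_ne_zero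
  · simp [hp0.ne']

lemma eq_zero_of_tsum_pow_eq_zero (hp0 : 0 < p) (hp1 : p < 1) {c : ℕ → ℂ} (hc : Summable c)
    (h : ∀ k : ℕ, ∑' n, c n * (((p : ℂ) ^ 2) ^ k) ^ n = 0) (n : ℕ) : c n = 0 := by
  refine coeff_eq_zero_of_frequently (fun z hz => ?_)
    ((tendsto_pow_nhdsNE_zero hp0 hp1).frequently (Frequently.of_forall h)) n
  refine Summable.of_norm_bounded hc.norm fun n => ?_
  rw [norm_mul, norm_pow]
  exact mul_le_of_le_one_right (norm_nonneg _) (pow_le_one₀ (norm_nonneg _) hz.le)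

/-- A summable complex mass distribution on the two-sided grid is determined by its moments:
the even and the odd moments determine the even and the odd part. -/
lemma eq_zero_of_moments_eq_zero (hp0 : 0 < p) (hp1 : p < 1) {z : ℕ ⊕ ℕ → ℂ} (hz : Summable z)
    (h : ∀ k : ℕ, ∑' s, z s * (grid p s : ℂ) ^ k = 0) (s : ℕ ⊕ ℕ) : z s = 0 := by
  have hl := hz.comp_injective Sum.inl_injective
  have hr := hz.comp_injective Sum.inr_injective
  have hpow : ∀ (c : ℕ → ℂ), Summable c → ∀ k : ℕ, Summable fun n => c n * ((p : ℂ) ^ n) ^ k := by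
    intro c hc k
    refine Summable.of_norm_bounded hc.norm fun n => ?_
    rw [norm_mul, norm_pow, norm_pow, Complex.norm_real, Real.norm_of_nonneg hp0.le]
    exact mul_le_of_le_one_right (norm_nonneg _)
      (pow_le_one₀ (by positivity) (pow_le_one₀ hp0.le hp1.le))
  have hsplit : ∀ k : ℕ, ∑' n, (z (.inl n) + (-1) ^ k * z (.inr n)) * ((p : ℂ) ^ n) ^ k = 0 := by
    intro k
    have hsl : Summable fun n => z (.inl n) * (grid p (.inl n) : ℂ) ^ k :=
      (hpow _ hl k).congr fun n => by simp [grid]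
    have hsr : Summable fun n => z (.inr n) * (grid p (.inr n) : ℂ) ^ k :=
      ((hpow _ hr k).mul_left ((-1) ^ k)).congr fun n => by
        simp only [Function.comp_apply, grid, Sum.elim_inr, Complex.ofReal_neg,
          Complex.ofReal_pow]
        rw [neg_pow]
        ring
    rw [← h k]
    refine Eq.trans ?_ ((hsl.tsum_add hsr).trans
      (Summable.tsum_sum (f := fun s => z s * (grid p s : ℂ) ^ k) hsl hsr).symm)
    refine tsum_congr fun n => ?_
    simp only [grid, Sum.elim_inl, Sum.elim_inr, Complex.ofReal_neg, Complex.ofReal_pow]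
    rw [neg_pow ((p : ℂ) ^ n)]
    ring
  have heven : ∀ n, z (.inl n) + z (.inr n) = 0 := by
    refine eq_zero_of_tsum_pow_eq_zero hp0 hp1 (hl.add hr) fun k => ?_
    rw [← hsplit (2 * k)]
    refine tsum_congr fun n => ?_
    rw [pow_mul (-1 : ℂ), neg_one_sq, one_pow, one_mul]
    simp only [← pow_mul]
    ring_nf
  have hodd : ∀ n, (z (.inl n) - z (.inr n)) * (p : ℂ) ^ n = 0 := by
    refine eq_zero_of_tsum_pow_eq_zero hp0 hp1 ?_ fun k => ?_
    · simpa using hpow _ (hl.sub hr) 1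
    rw [← hsplit (2 * k + 1)]
    refine tsum_congr fun n => ?_
    rw [pow_succ (-1 : ℂ), pow_mul (-1 : ℂ), neg_one_sq, one_pow]
    simp only [← pow_mul]
    ring
  have hodd' : ∀ n, z (.inl n) - z (.inr n) = 0 := fun n =>
    (mul_eq_zero.1 (hodd n)).resolve_right (pow_ne_zero _ (by exact_mod_cast hp0.ne'))
  rcases s with n | n
  · linear_combination (heven n + hodd' n) / 2
  · linear_combination (heven n - hodd' n) / 2

end Moments

section HilbertSpace

open scoped InnerProductSpace

variable {p b : ℝ}

/-- Square root of the weight `|y| v(y)` of the grid point `s`. -/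
noncomputable def weightSqrt (p b : ℝ) (s : ℕ ⊕ ℕ) : ℝ :=
  Real.sqrt (|grid p s| * weightRatio p b (grid p s))

/-- The square root of `|y| / v(y)` at the grid point `s`. -/
noncomputable def coweightSqrt (p b : ℝ) (s : ℕ ⊕ ℕ) : ℝ :=
  Real.sqrt (|grid p s| / weightRatio p b (grid p s))

lemma weightSqrt_pos (hp0 : 0 < p) (hp1 : p < 1) (hb0 : 0 < b) (hb1 : b < 1) (s : ℕ ⊕ ℕ) :
    0 < weightSqrt p b s :=
  Real.sqrt_pos.2 (mul_pos (abs_grid_pos hp0 s)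
    (weightRatio_pos hp0 hp1 hb0 hb1 (abs_grid_le_one hp0 hp1 s)))

lemma coweightSqrt_mul_weightSqrt (hp0 : 0 < p) (hp1 : p < 1) (hb0 : 0 < b) (hb1 : b < 1)
    (s : ℕ ⊕ ℕ) : coweightSqrt p b s * weightSqrt p b s = |grid p s| := by
  have h1 := weightRatio_pos hp0 hp1 hb0 hb1 (abs_grid_le_one hp0 hp1 s)
  have h2 := abs_grid_pos hp0 s
  rw [coweightSqrt, weightSqrt, ← Real.sqrt_mul (by positivity)]
  rw [show |grid p s| / weightRatio p b (grid p s) * (|grid p s| * weightRatio p b (grid p s)) =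
    |grid p s| * |grid p s| by field_simp]
  exact Real.sqrt_mul_self h2.le

lemma coweightSqrt_mul_weightRatio (hp0 : 0 < p) (hp1 : p < 1) (hb0 : 0 < b) (hb1 : b < 1)
    (s : ℕ ⊕ ℕ) :
    coweightSqrt p b s * weightRatio p b (grid p s) = weightSqrt p b s := by
  have h1 := weightRatio_pos hp0 hp1 hb0 hb1 (abs_grid_le_one hp0 hp1 s)
  have h2 := abs_grid_pos hp0 s
  rw [coweightSqrt, weightSqrt]
  nth_rw 2 [← Real.sqrt_sq h1.le]
  rw [← Real.sqrt_mul (by positivity)]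
  congr 1
  field_simp

lemma memℓp_two_of_summable_sq {f : ℕ ⊕ ℕ → ℂ} (h : Summable fun s => ‖f s‖ ^ 2) :
    Memℓp f 2 := by
  refine memℓp_gen ?_
  simpa using h

lemma memℓp_weightSqrt (hp0 : 0 < p) (hp1 : p < 1) (hb0 : 0 < b) (hb1 : b < 1) :
    Memℓp (fun s => (weightSqrt p b s : ℂ)) 2 := by
  obtain ⟨C, hC⟩ := exists_bound_weightRatio hp0 hp1 hb0 hb1
  refine memℓp_two_of_summable_sq (Summable.of_nonneg_of_le (fun s => by positivity) (fun s => ?_)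
    ((summable_abs_grid hp0 hp1).mul_right C))
  have h1 := weightRatio_pos hp0 hp1 hb0 hb1 (abs_grid_le_one hp0 hp1 s)
  rw [Complex.norm_real, weightSqrt, Real.norm_of_nonneg (Real.sqrt_nonneg _),
    Real.sq_sqrt (by positivity)]
  exact mul_le_mul_of_nonneg_left (hC s).1 (abs_nonneg _)

lemma memℓp_coweightSqrt (hp0 : 0 < p) (hp1 : p < 1) (hb0 : 0 < b) (hb1 : b < 1) :
    Memℓp (fun s => (coweightSqrt p b s : ℂ)) 2 := by
  obtain ⟨C, hC⟩ := exists_bound_weightRatio hp0 hp1 hb0 hb1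
  refine memℓp_two_of_summable_sq (Summable.of_nonneg_of_le (fun s => by positivity) (fun s => ?_)
    ((summable_abs_grid hp0 hp1).mul_right C))
  have h1 := weightRatio_pos hp0 hp1 hb0 hb1 (abs_grid_le_one hp0 hp1 s)
  rw [Complex.norm_real, coweightSqrt, Real.norm_of_nonneg (Real.sqrt_nonneg _),
    Real.sq_sqrt (by positivity), div_eq_mul_inv]
  exact mul_le_mul_of_nonneg_left (hC s).2 (abs_nonneg _)

/-- The vector `s ↦ w(s) ∏_{i < k} (y_s + p^i)` of `ℓ²`, `w` being the square root of the
weight. -/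
noncomputable def termVec (hp0 : 0 < p) (hp1 : p < 1) (hb0 : 0 < b) (hb1 : b < 1) (k : ℕ) :
    lp (fun _ : ℕ ⊕ ℕ => ℂ) 2 :=
  ⟨fun s => (weightSqrt p b s : ℂ) * (shiftProd p (grid p s) k : ℝ),
    ((memℓp_weightSqrt hp0 hp1 hb0 hb1).const_mul ((2 : ℂ) ^ k)).mono' fun s => by
      rw [norm_mul, norm_mul, mul_comm, Complex.norm_real, Complex.norm_real, norm_pow]
      gcongr
      simpa using abs_shiftProd_le hp0 hp1 (abs_grid_le_one hp0 hp1 s) k⟩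

/-- For each grid point `t` the row `s ↦ 1_{s right of t} √(|y_s| / v(y_s))` of the Volterra-type
operator that inverts the first `q`-difference relation. -/
noncomputable def rowVec (hp0 : 0 < p) (hp1 : p < 1) (hb0 : 0 < b) (hb1 : b < 1) (t : ℕ ⊕ ℕ) :
    lp (fun _ : ℕ ⊕ ℕ => ℂ) 2 :=
  ⟨fun s => (rightOf t s : ℂ) * (coweightSqrt p b s : ℂ),
    (memℓp_coweightSqrt hp0 hp1 hb0 hb1).mono' fun s => by
      rw [norm_mul, Complex.norm_real, Real.norm_of_nonneg (rightOf_nonneg t s)]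
      exact mul_le_of_le_one_left (norm_nonneg _) (rightOf_le_one t s)⟩

lemma norm_rowVec_le (hp0 : 0 < p) (hp1 : p < 1) (hb0 : 0 < b) (hb1 : b < 1) (t : ℕ ⊕ ℕ) :
    ‖rowVec hp0 hp1 hb0 hb1 t‖ ≤
      ‖(⟨_, memℓp_coweightSqrt hp0 hp1 hb0 hb1⟩ : lp (fun _ : ℕ ⊕ ℕ => ℂ) 2)‖ := by
  refine lp.norm_mono two_ne_zero fun s => ?_
  change ‖(rightOf t s : ℂ) * (coweightSqrt p b s : ℂ)‖ ≤ ‖(coweightSqrt p b s : ℂ)‖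
  rw [norm_mul, Complex.norm_real, Real.norm_of_nonneg (rightOf_nonneg t s)]
  exact mul_le_of_le_one_left (norm_nonneg _) (rightOf_le_one t s)

lemma norm_termVec_le (hp0 : 0 < p) (hp1 : p < 1) (hb0 : 0 < b) (hb1 : b < 1) (k : ℕ) :
    ‖termVec hp0 hp1 hb0 hb1 k‖ ≤ 2 ^ k * ‖termVec hp0 hp1 hb0 hb1 0‖ := by
  have h1 : ‖termVec hp0 hp1 hb0 hb1 k‖ ≤ ‖(2 : ℂ) ^ k • termVec hp0 hp1 hb0 hb1 0‖ := by
    refine lp.norm_mono two_ne_zero fun s => ?_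
    change ‖(weightSqrt p b s : ℂ) * (shiftProd p (grid p s) k : ℝ)‖ ≤
      ‖(2 : ℂ) ^ k * ((weightSqrt p b s : ℂ) * (shiftProd p (grid p s) 0 : ℝ))‖
    rw [norm_mul, norm_mul, mul_comm, Complex.norm_real, Complex.norm_real, norm_pow]
    have h2 := abs_shiftProd_le hp0 hp1 (abs_grid_le_one hp0 hp1 s) k
    have h3 : shiftProd p (grid p s) 0 = 1 := by simp [shiftProd]
    rw [h3, Complex.ofReal_one, mul_one, Complex.norm_real]
    gcongr
    simpa using h2
  rwa [norm_smul, norm_pow, Complex.norm_ofNat] at h1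

/-- The vector `s ↦ w(s) φ(y_s, μ)` of `ℓ²`, where `φ` is the Bessel series with parameter
`b p`. -/
noncomputable def besselVec (hp0 : 0 < p) (hp1 : p < 1) (hb0 : 0 < b) (hb1 : b < 1) (μ : ℂ) :
    lp (fun _ : ℕ ⊕ ℕ => ℂ) 2 :=
  ∑' k : ℕ, ((seriesCoeff p (b * p) k : ℂ) * μ ^ k) • termVec hp0 hp1 hb0 hb1 k

lemma norm_smul_termVec_le (hp0 : 0 < p) (hp1 : p < 1) (hb0 : 0 < b) (hb1 : b < 1) {μ : ℂ}
    {R : ℝ} (hμ : ‖μ‖ ≤ R) (k : ℕ) :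
    ‖((seriesCoeff p (b * p) k : ℂ) * μ ^ k) • termVec hp0 hp1 hb0 hb1 k‖ ≤
      |seriesCoeff p (b * p) k| * (2 * R) ^ k * ‖termVec hp0 hp1 hb0 hb1 0‖ := by
  rw [norm_smul, norm_mul, Complex.norm_real, Real.norm_eq_abs, norm_pow]
  have h1 := norm_termVec_le hp0 hp1 hb0 hb1 k
  have hR : 0 ≤ R := (norm_nonneg μ).trans hμ
  calc _ ≤ |seriesCoeff p (b * p) k| * R ^ k * (2 ^ k * ‖termVec hp0 hp1 hb0 hb1 0‖) := by gcongr
    _ = _ := by ring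

lemma summable_bound_termVec (hp0 : 0 < p) (hp1 : p < 1) (hb0 : 0 < b) (hb1 : b < 1) {R : ℝ}
    (hR : 0 < R) : Summable fun k =>
      |seriesCoeff p (b * p) k| * (2 * R) ^ k * ‖termVec hp0 hp1 hb0 hb1 0‖ :=
  (summable_seriesCoeff hp0 hp1 (mul_pos hb0 hp0) (by nlinarith) (mul_pos two_pos hR)).mul_right _

lemma hasSum_besselVec (hp0 : 0 < p) (hp1 : p < 1) (hb0 : 0 < b) (hb1 : b < 1) (μ : ℂ) :
    HasSum (fun k : ℕ => ((seriesCoeff p (b * p) k : ℂ) * μ ^ k) • termVec hp0 hp1 hb0 hb1 k)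
      (besselVec hp0 hp1 hb0 hb1 μ) := by
  have hR : 0 < ‖μ‖ + 1 := by positivity
  exact (Summable.of_norm_bounded (summable_bound_termVec hp0 hp1 hb0 hb1 hR)
    fun k => norm_smul_termVec_le hp0 hp1 hb0 hb1 (by linarith) k).hasSum

lemma differentiable_besselVec (hp0 : 0 < p) (hp1 : p < 1) (hb0 : 0 < b) (hb1 : b < 1) :
    Differentiable ℂ (besselVec hp0 hp1 hb0 hb1) := by
  intro μ
  have hR : 0 < ‖μ‖ + 1 := by positivity
  have h1 : DifferentiableOn ℂ (besselVec hp0 hp1 hb0 hb1) (Metric.ball 0 (‖μ‖ + 1)) :=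
    Complex.differentiableOn_tsum_of_summable_norm (summable_bound_termVec hp0 hp1 hb0 hb1 hR)
      (fun k => by fun_prop) Metric.isOpen_ball
      fun k w hw => norm_smul_termVec_le hp0 hp1 hb0 hb1 (mem_ball_zero_iff.1 hw).le k
  exact h1.differentiableAt (Metric.isOpen_ball.mem_nhds (by simp))

lemma besselVec_apply (hp0 : 0 < p) (hp1 : p < 1) (hb0 : 0 < b) (hb1 : b < 1) (μ : ℂ)
    (s : ℕ ⊕ ℕ) : besselVec hp0 hp1 hb0 hb1 μ s =
      weightSqrt p b s * besselSeries p (b * p) (grid p s) μ := by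
  have h1 := (hasSum_besselVec hp0 hp1 hb0 hb1 μ).mapL
    (lp.evalCLM ℂ (fun _ : ℕ ⊕ ℕ => ℂ) 2 s)
  have h2 := (hasSum_besselSeries hp0 hp1 (mul_pos hb0 hp0) (by nlinarith)
    (abs_grid_le_one hp0 hp1 s) μ).mul_left (weightSqrt p b s : ℂ)
  refine h1.unique (h2.congr_fun fun k => ?_)
  change (seriesCoeff p (b * p) k : ℂ) * μ ^ k *
    ((weightSqrt p b s : ℂ) * (shiftProd p (grid p s) k : ℝ)) = _
  push_cast
  ring

lemma besselVec_ne_zero (hp0 : 0 < p) (hp1 : p < 1) (hb0 : 0 < b) (hb1 : b < 1) (μ : ℂ) :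
    besselVec hp0 hp1 hb0 hb1 μ ≠ 0 := by
  intro h0
  have h1 := besselVec_apply hp0 hp1 hb0 hb1 μ (.inr 0)
  rw [h0, lp.coeFn_zero, Pi.zero_apply] at h1
  have h2 : grid p (.inr 0) = -1 := by simp [grid]
  rw [h2, besselSeries_neg_one, mul_one] at h1
  exact (weightSqrt_pos hp0 hp1 hb0 hb1 (.inr 0)).ne' (Complex.ofReal_eq_zero.1 h1.symm)

/-- The vectors `besselVec μ` are total: a vector orthogonal to all of them is orthogonal to the
coefficients of their power series, so that all its moments vanish. -/
lemma eq_zero_of_inner_besselVec (hp0 : 0 < p) (hp1 : p < 1) (hb0 : 0 < b) (hb1 : b < 1)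
    (x : lp (fun _ : ℕ ⊕ ℕ => ℂ) 2) (hx : ∀ μ, ⟪x, besselVec hp0 hp1 hb0 hb1 μ⟫_ℂ = 0) :
    x = 0 := by
  have h1 : ∀ μ : ℂ, HasSum (fun k => ((seriesCoeff p (b * p) k : ℂ) *
      ⟪x, termVec hp0 hp1 hb0 hb1 k⟫_ℂ) * μ ^ k) 0 := by
    intro μ
    have h2 := (hasSum_besselVec hp0 hp1 hb0 hb1 μ).mapL (innerSL ℂ x)
    rw [innerSL_apply_apply, hx] at h2
    refine h2.congr_fun fun k => ?_
    rw [innerSL_apply_apply, inner_smul_right]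
    ring
  have h3 : ∀ k, ⟪x, termVec hp0 hp1 hb0 hb1 k⟫_ℂ = 0 := by
    intro k
    have h4 := coeff_eq_zero_of_frequently (fun z _ => (h1 z).summable)
      (Frequently.of_forall fun z => (h1 z).tsum_eq) k
    refine (mul_eq_zero.1 h4).resolve_left ?_
    exact_mod_cast seriesCoeff_ne_zero hp0 hp1 (mul_pos hb0 hp0) (by nlinarith) k
  set z : ℕ ⊕ ℕ → ℂ := fun s => (starRingEnd ℂ) (x s) * weightSqrt p b s with hz
  have hsum : ∀ k, HasSum (fun s => z s * (shiftProd p (grid p s) k : ℝ)) 0 := by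
    intro k
    rw [← h3 k]
    refine (lp.hasSum_inner x (termVec hp0 hp1 hb0 hb1 k)).congr_fun fun s => ?_
    change _ = (weightSqrt p b s : ℂ) * (shiftProd p (grid p s) k : ℝ) * (starRingEnd ℂ) (x s)
    rw [hz]
    ring
  have hz_summable : Summable z := by simpa [shiftProd] using (hsum 0).summable
  -- the products `∏_{i < k} (y + p^i)` span all polynomials in `y`
  have hmom : ∀ m k, HasSum (fun s => z s * (shiftProd p (grid p s) k : ℝ) *
      (grid p s : ℂ) ^ m) 0 := by
    intro m
    induction m with
    | zero => simpa using hsum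
    | succ m ih =>
      intro k
      have h5 := (ih (k + 1)).sub ((ih k).mul_left ((p : ℂ) ^ k))
      rw [mul_zero, sub_zero] at h5
      refine h5.congr_fun fun s => ?_
      rw [shiftProd_succ]
      push_cast
      ring
  have hz0 := eq_zero_of_moments_eq_zero hp0 hp1 hz_summable fun k => by
    simpa [shiftProd] using (hmom k 0).tsum_eq
  ext s
  have h6 := hz0 s
  rw [hz, mul_eq_zero] at h6
  have h7 : (weightSqrt p b s : ℂ) ≠ 0 := by
    exact_mod_cast (weightSqrt_pos hp0 hp1 hb0 hb1 s).ne'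
  simpa using h6.resolve_right h7

lemma inner_rowVec_besselVec (hp0 : 0 < p) (hp1 : p < 1) (hb0 : 0 < b) (hb1 : b < 1) (μ : ℂ)
    (t : ℕ ⊕ ℕ) :
    ((b / (1 - b) : ℝ) : ℂ) * μ * ⟪rowVec hp0 hp1 hb0 hb1 t, besselVec hp0 hp1 hb0 hb1 μ⟫_ℂ =
      besselSeries p b (grid p t) μ - besselSeries p b 1 μ := by
  have h1 := (lp.hasSum_inner (rowVec hp0 hp1 hb0 hb1 t)
    (besselVec hp0 hp1 hb0 hb1 μ)).mul_left (((b / (1 - b) : ℝ) : ℂ) * μ)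
  refine h1.unique ((hasSum_rightOf_left hp0 hp1 hb0 hb1 μ t).congr_fun fun s => ?_)
  rw [besselVec_apply]
  change _ * (_ * (starRingEnd ℂ) ((rightOf t s : ℂ) * (coweightSqrt p b s : ℂ))) = _
  rw [map_mul, Complex.conj_ofReal, Complex.conj_ofReal,
    ← coweightSqrt_mul_weightSqrt hp0 hp1 hb0 hb1 s]
  push_cast
  ring

/-- The Bessel vectors form a resolvent family for the positive operator
`∑ U_t |r_t⟩⟨r_t|`, with the Bessel series at `y = 1` as characteristic function. -/
lemma isResolventFamily_besselVec (hp0 : 0 < p) (hp1 : p < 1) (hb0 : 0 < b) (hb1 : b < 1) :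
    IsResolventFamily (sumRankOne (dualWeight p b) (rowVec hp0 hp1 hb0 hb1)) b
      (∑' t, (((1 - b) * dualWeight p b t : ℝ) : ℂ) • rowVec hp0 hp1 hb0 hb1 t)
      (besselVec hp0 hp1 hb0 hb1) (besselSeries p b 1) := by
  have hU := summable_dualWeight hp0 hp1 hb0 hb1
  have hUpos := dualWeight_pos hp0 hp1 hb0 hb1
  have hU0 := fun t => (hUpos t).le
  obtain ⟨B, hr⟩ : ∃ B, ∀ t, ‖rowVec hp0 hp1 hb0 hb1 t‖ ≤ B :=
    ⟨_, norm_rowVec_le hp0 hp1 hb0 hb1⟩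
  have hE : HasSum (fun t => (((1 - b) * dualWeight p b t : ℝ) : ℂ) • rowVec hp0 hp1 hb0 hb1 t)
      (∑' t, (((1 - b) * dualWeight p b t : ℝ) : ℂ) • rowVec hp0 hp1 hb0 hb1 t) := by
    refine (Summable.of_norm_bounded ((hU.mul_left (1 - b)).mul_right B) fun t => ?_).hasSum
    have h3 : 0 ≤ (1 - b) * dualWeight p b t := mul_nonneg (by linarith) (hU0 t)
    rw [norm_smul, Complex.norm_real, Real.norm_of_nonneg h3]
    exact mul_le_mul_of_nonneg_left (hr t) h3
  have hb' : (1 : ℝ) - b ≠ 0 := by linarith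
  refine ⟨hb0, isCompactOperator_sumRankOne hU hU0 hr, isSymmetric_sumRankOne hU hU0 hr,
    re_inner_sumRankOne_nonneg hU hU0 hr, fun x hx => ?_, fun μ => ?_,
    eq_zero_of_inner_besselVec hp0 hp1 hb0 hb1, differentiable_besselVec hp0 hp1 hb0 hb1,
    differentiable_besselSeries hp0 hp1 hb0 hb1 (by simp), besselSeries_at_zero 1,
    besselVec_ne_zero hp0 hp1 hb0 hb1⟩
  · have h1 := hE.mapL (innerSL ℂ x)
    rw [← innerSL_apply_apply ℂ x, ← h1.tsum_eq]
    refine (tsum_congr fun t => ?_).trans tsum_zero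
    rw [innerSL_apply_apply, inner_smul_right, ← inner_conj_symm,
      inner_eq_zero_of_sumRankOne_eq_zero hU hUpos hr hx t, map_zero, mul_zero]
  · rw [sub_eq_iff_eq_add]
    have h1 := (hE.const_smul (besselSeries p b 1 μ)).add
      ((hasSum_sumRankOne_apply hU hU0 hr (besselVec hp0 hp1 hb0 hb1 μ)).const_smul ((b : ℂ) * μ))
    ext s
    have h2 := h1.mapL (lp.evalCLM ℂ (fun _ : ℕ ⊕ ℕ => ℂ) 2 s)
    refine HasSum.unique ?_ h2
    have h3 := (hasSum_rightOf_right hp0 hp1 hb0 hb1 μ s).mul_left (coweightSqrt p b s : ℂ)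
    rw [← mul_assoc, ← Complex.ofReal_mul, coweightSqrt_mul_weightRatio hp0 hp1 hb0 hb1,
      ← besselVec_apply] at h3
    refine h3.congr_fun fun t => ?_
    have h4 := inner_rowVec_besselVec hp0 hp1 hb0 hb1 μ t
    change besselSeries p b 1 μ * ((((1 - b) * dualWeight p b t : ℝ) : ℂ) *
        ((rightOf t s : ℂ) * (coweightSqrt p b s : ℂ))) +
      (b : ℂ) * μ * (((dualWeight p b t : ℂ) * ⟪rowVec hp0 hp1 hb0 hb1 t,
        besselVec hp0 hp1 hb0 hb1 μ⟫_ℂ) * ((rightOf t s : ℂ) * (coweightSqrt p b s : ℂ))) = _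
    have h5 : (1 - (b : ℂ)) * ((b / (1 - b) : ℝ) : ℂ) = b := by
      have h6 : (1 - b) * (b / (1 - b)) = b := by field_simp
      exact_mod_cast h6
    push_cast at h4 h5 ⊢
    linear_combination (dualWeight p b t : ℂ) * (rightOf t s : ℂ) * (coweightSqrt p b s : ℂ) *
      ((1 - (b : ℂ)) * h4 - μ * ⟪rowVec hp0 hp1 hb0 hb1 t, besselVec hp0 hp1 hb0 hb1 μ⟫_ℂ * h5)

lemma not_finiteDimensional_lp : ¬ FiniteDimensional ℂ (lp (fun _ : ℕ ⊕ ℕ => ℂ) 2) := by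
  classical
  intro h
  have h1 : Orthonormal ℂ fun s : ℕ ⊕ ℕ => lp.single (E := fun _ : ℕ ⊕ ℕ => ℂ) 2 s (1 : ℂ) := by
    rw [orthonormal_iff_ite]
    intro s t
    rw [lp.inner_single_left, lp.single_apply]
    by_cases hst : s = t
    · subst hst; simp
    · simp [hst]
  exact Infinite.not_finite (h1.linearIndependent.finite)

end HilbertSpace

end BigQBessel

/-! ### The transform and the sampling functions as inner products -/

namespace BigQBessel

section Dictionary

open scoped InnerProductSpace

variable {q α : ℝ}

lemma base_param_mem (hq0 : 0 < q) (hq1 : q < 1) (hα : -1 < α) :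
    (0 < q ^ 2 ∧ q ^ 2 < 1) ∧ 0 < q ^ (2 * α + 2) ∧ q ^ (2 * α + 2) < 1 :=
  ⟨⟨by positivity, pow_lt_one₀ hq0.le hq1 two_ne_zero⟩, Real.rpow_pos_of_pos hq0 _,
    Real.rpow_lt_one hq0.le hq1 (by linarith)⟩

lemma rpow_mul_sq (hq0 : 0 < q) (β : ℝ) : q ^ β * q ^ 2 = q ^ (β + 2) := by
  rw [Real.rpow_add hq0, Real.rpow_two]

lemma ofReal_qPochhammer (a p : ℝ) (k : ℕ) :
    ((qPochhammer a p k : ℝ) : ℂ) = qPochhammer (a : ℂ) (p : ℂ) k := by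
  simp [qPochhammer]

lemma ofReal_shiftProd {p y : ℝ} (hy : y ≠ 0) (k : ℕ) :
    ((shiftProd p y k : ℝ) : ℂ) = (y : ℂ) ^ k * qPochhammer (-1 / (y : ℂ)) (p : ℂ) k := by
  have hy' : (y : ℂ) ≠ 0 := by exact_mod_cast hy
  rw [qPochhammer, shiftProd, Complex.ofReal_prod]
  conv_rhs => rw [← Finset.card_range k, ← Finset.prod_const, Finset.card_range]
  rw [← Finset.prod_mul_distrib]
  refine Finset.prod_congr rfl fun i _ => ?_
  push_cast
  field_simp
  ring

lemma bigQBessel_eq_besselSeries {x : ℝ} (hx : x ≠ 0) (l : ℂ) :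
    bigQBessel q α (x : ℂ) l = besselSeries (q ^ 2) (q ^ (2 * α + 2)) (x ^ 2) (l ^ 2) := by
  rw [bigQBessel, oneOnePhi, besselSeries]
  refine tsum_congr fun k => ?_
  rw [Complex.ofReal_mul, ofReal_shiftProd (pow_ne_zero 2 hx), seriesCoeff]
  simp only [Complex.ofReal_div, Complex.ofReal_mul, ofReal_qPochhammer, Complex.ofReal_pow,
    Complex.ofReal_neg, Complex.ofReal_one, mul_pow]
  ring

lemma bigQBessel_one (l : ℂ) :
    bigQBessel q α 1 l = besselSeries (q ^ 2) (q ^ (2 * α + 2)) 1 (l ^ 2) := by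
  have h := bigQBessel_eq_besselSeries (q := q) (α := α) one_ne_zero l
  rwa [Complex.ofReal_one, one_pow] at h

lemma weight_eq (hq0 : 0 < q) (x : ℝ) :
    weight q α x = x * weightRatio (q ^ 2) (q ^ (2 * α + 2)) (x ^ 2) := by
  rw [weight, weightRatio, rpow_mul_sq hq0, mul_div_assoc, add_assoc]
  norm_num

lemma positiveZeros_eq : positiveZeros q α =
    sqrtZeros (besselSeries (q ^ 2) (q ^ (2 * α + 2)) 1) := by
  ext t
  simp only [positiveZeros, sqrtZeros, Set.mem_ofPred_eq, bigQBessel_one]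

lemma deriv_bigQBessel_one (hq0 : 0 < q) (hq1 : q < 1) (hα : -1 < α) (l : ℂ) :
    deriv (fun m : ℂ => bigQBessel q α 1 m) l =
      2 * l * deriv (besselSeries (q ^ 2) (q ^ (2 * α + 2)) 1) (l ^ 2) := by
  obtain ⟨⟨hp0, hp1⟩, hb0, hb1⟩ := base_param_mem hq0 hq1 hα
  have h1 := (differentiable_besselSeries hp0 hp1 hb0 hb1 (y := 1) (by simp) (l ^ 2)).hasDerivAt
  have h2 := h1.comp l (hasDerivAt_pow 2 l)
  rw [funext fun m => bigQBessel_one (q := q) (α := α) m]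
  refine h2.deriv.trans ?_
  norm_num
  ring

/-- The vector of `ℓ²` that represents `f`: conjugated, scaled by the square root of the weight,
and extended by zero to the negative half of the grid. -/
noncomputable def signalFun (q α : ℝ) (f : ℝ → ℂ) : ℕ ⊕ ℕ → ℂ :=
  Sum.elim (fun n => (weightSqrt (q ^ 2) (q ^ (2 * α + 2)) (.inl n) : ℂ) *
    (starRingEnd ℂ) (f (1 * q ^ n))) fun _ => 0

lemma pow_mul_weight (hq0 : 0 < q) (hq1 : q < 1) (hα : -1 < α) (n : ℕ) :
    q ^ n * weight q α (1 * q ^ n) = weightSqrt (q ^ 2) (q ^ (2 * α + 2)) (.inl n) ^ 2 := by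
  obtain ⟨⟨hp0, hp1⟩, hb0, hb1⟩ := base_param_mem hq0 hq1 hα
  have h1 := abs_grid_le_one hp0 hp1 (.inl n)
  have h2 := weightRatio_pos hp0 hp1 hb0 hb1 h1
  rw [weight_eq hq0, weightSqrt, Real.sq_sqrt (by positivity)]
  have h3 : (1 * q ^ n) ^ 2 = (q ^ 2) ^ n := by ring
  rw [h3]
  simp only [grid, Sum.elim_inl]
  rw [abs_of_pos (pow_pos hp0 n)]
  ring

lemma memℓp_signalFun (hq0 : 0 < q) (hq1 : q < 1) (hα : -1 < α) {f : ℝ → ℂ}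
    (hf : MemL2q q α f) : Memℓp (signalFun q α f) 2 := by
  refine memℓp_two_of_summable_sq (HasSum.sum (f := fun s => ‖signalFun q α f s‖ ^ 2)
    (hf.hasSum.congr_fun fun n => ?_) (hasSum_zero.congr_fun fun n => ?_)).summable
  · rw [smul_eq_mul, ← mul_assoc, pow_mul_weight hq0 hq1 hα]
    simp [signalFun, mul_pow]
  · simp [signalFun]

/-- The `q`-integral that defines the transform is an inner product in `ℓ²`. -/
lemma hasSum_hankelIntegrand (hq0 : 0 < q) (hq1 : q < 1) (hα : -1 < α) (hp0 : 0 < q ^ 2)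
    (hp1 : q ^ 2 < 1) (hb0 : 0 < q ^ (2 * α + 2)) (hb1 : q ^ (2 * α + 2) < 1) {f : ℝ → ℂ}
    (hf : MemL2q q α f) (l : ℂ) :
    HasSum (fun n : ℕ => q ^ n • hankelIntegrand q α f l (1 * q ^ n))
      ⟪(⟨_, memℓp_signalFun hq0 hq1 hα hf⟩ : lp (fun _ : ℕ ⊕ ℕ => ℂ) 2),
        besselVec hp0 hp1 hb0 hb1 (l ^ 2)⟫_ℂ := by
  have h1 := lp.hasSum_inner (𝕜 := ℂ) (⟨_, memℓp_signalFun hq0 hq1 hα hf⟩ : lp (fun _ : ℕ ⊕ ℕ => ℂ) 2)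
    (besselVec hp0 hp1 hb0 hb1 (l ^ 2))
  rw [← Function.Injective.hasSum_iff Sum.inl_injective] at h1
  · refine h1.congr_fun fun n => ?_
    have hx : 1 * q ^ n ≠ 0 := by simp [hq0.ne']
    have h2 : (1 * q ^ n) ^ 2 = grid (q ^ 2) (.inl n) := by
      simp only [grid, Sum.elim_inl]
      ring
    have h3 : q ^ (2 * (α + 1) + 2) = q ^ (2 * α + 2) * q ^ 2 := by
      rw [rpow_mul_sq hq0]
      ring_nf
    have h4 := congrArg (fun r : ℝ => (r : ℂ)) (pow_mul_weight hq0 hq1 hα n)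
    rw [hankelIntegrand, bigQBessel_eq_besselSeries hx, h2, h3, Function.comp_apply,
      besselVec_apply, Complex.real_smul]
    change _ = _ * (starRingEnd ℂ) ((weightSqrt (q ^ 2) (q ^ (2 * α + 2)) (.inl n) : ℂ) *
      (starRingEnd ℂ) (f (1 * q ^ n)))
    rw [map_mul, Complex.conj_ofReal, Complex.conj_conj]
    push_cast at h4 ⊢
    linear_combination f (1 * q ^ n) * besselSeries (q ^ 2) (q ^ (2 * α + 2) * q ^ 2)
      (grid (q ^ 2) (.inl n)) (l ^ 2) * h4
  · rintro (n | n) hn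
    · exact absurd ⟨n, rfl⟩ hn
    · change _ * (starRingEnd ℂ) (0 : ℂ) = 0
      rw [map_zero, mul_zero]

lemma hankelTransform_eq (hq0 : 0 < q) (hq1 : q < 1) (hα : -1 < α) (hp0 : 0 < q ^ 2)
    (hp1 : q ^ 2 < 1) (hb0 : 0 < q ^ (2 * α + 2)) (hb1 : q ^ (2 * α + 2) < 1) {f : ℝ → ℂ}
    (hf : MemL2q q α f) (l : ℂ) :
    hankelTransform q α f l = (1 - q : ℝ) *
      ⟪(⟨_, memℓp_signalFun hq0 hq1 hα hf⟩ : lp (fun _ : ℕ ⊕ ℕ => ℂ) 2),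
        besselVec hp0 hp1 hb0 hb1 (l ^ 2)⟫_ℂ := by
  rw [hankelTransform, qIntegral, (hasSum_hankelIntegrand hq0 hq1 hα hp0 hp1 hb0 hb1 hf l).tsum_eq,
    mul_one, Complex.real_smul]

/-- The sampling functions are the normalized pairings of the Bessel vectors with the
eigenvectors. -/
lemma samplingFunction_eq (hq0 : 0 < q) (hq1 : q < 1) (hα : -1 < α) (hp0 : 0 < q ^ 2)
    (hp1 : q ^ 2 < 1) (hb0 : 0 < q ^ (2 * α + 2)) (hb1 : q ^ (2 * α + 2) < 1) {k : ℕ}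
    (hk : besselZero q α k ∈ sqrtZeros (besselSeries (q ^ 2) (q ^ (2 * α + 2)) 1)) (l : ℂ) :
    samplingFunction q α k l =
      ⟪besselVec hp0 hp1 hb0 hb1 ((besselZero q α k : ℂ) ^ 2),
        besselVec hp0 hp1 hb0 hb1 (l ^ 2)⟫_ℂ /
      ⟪besselVec hp0 hp1 hb0 hb1 ((besselZero q α k : ℂ) ^ 2),
        besselVec hp0 hp1 hb0 hb1 ((besselZero q α k : ℂ) ^ 2)⟫_ℂ := by
  have D := isResolventFamily_besselVec hp0 hp1 hb0 hb1
  rw [samplingFunction]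
  split_ifs with h
  · rw [h, div_self]
    simpa using D.ne_zero _
  · rw [D.inner_div_inner hk h, bigQBessel_one, deriv_bigQBessel_one hq0 hq1 hα]
    have h0 : (besselZero q α k : ℂ) ≠ 0 := by exact_mod_cast hk.1.ne'
    rw [show (l ^ 2 - (besselZero q α k : ℂ) ^ 2) * (2 * (besselZero q α k : ℂ) *
        deriv (besselSeries (q ^ 2) (q ^ (2 * α + 2)) 1) ((besselZero q α k : ℂ) ^ 2)) =
      2 * (besselZero q α k : ℂ) * ((l ^ 2 - (besselZero q α k : ℂ) ^ 2) *
        deriv (besselSeries (q ^ 2) (q ^ (2 * α + 2)) 1) ((besselZero q α k : ℂ) ^ 2)) by ring]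
    exact mul_div_mul_left _ _ (mul_ne_zero two_ne_zero h0)

end Dictionary

end BigQBessel

theorem theorem6p1 (q α : ℝ) (hq0 : 0 < q) (hq1 : q < 1) (hα : -1 < α) :
    -- the `j_k` enumerate all positive zeros of `J_α(1, ·; q²)` increasingly, and are simple
    StrictMono (BigQBessel.besselZero q α) ∧
    Set.range (BigQBessel.besselZero q α) = BigQBessel.positiveZeros q α ∧
    (∀ k : ℕ, deriv (fun m : ℂ => BigQBessel.bigQBessel q α 1 m)
      (BigQBessel.besselZero q α k : ℂ) ≠ 0) ∧
    -- the singularities of the sampling functions are removable, with the values chosen there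
    (∀ k : ℕ, Differentiable ℂ (BigQBessel.samplingFunction q α k)) ∧
    ∀ f : ℝ → ℂ, BigQBessel.MemL2q q α f →
      (∀ l : ℂ, BigQBessel.QIntegrable q 1 (BigQBessel.hankelIntegrand q α f l)) ∧
      (∀ l : ℂ, HasSum
        (fun k : ℕ => BigQBessel.hankelTransform q α f (BigQBessel.besselZero q α k : ℂ) *
          BigQBessel.samplingFunction q α k l)
        (BigQBessel.hankelTransform q α f l)) ∧
      ∀ K : Set ℂ, IsCompact K →
        TendstoUniformlyOn
          (fun (N : ℕ) (l : ℂ) => ∑ k ∈ Finset.range N,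
            BigQBessel.hankelTransform q α f (BigQBessel.besselZero q α k : ℂ) *
              BigQBessel.samplingFunction q α k l)
          (BigQBessel.hankelTransform q α f) atTop K := by
  obtain ⟨⟨hp0, hp1⟩, hb0, hb1⟩ := BigQBessel.base_param_mem hq0 hq1 hα
  have D := BigQBessel.isResolventFamily_besselVec hp0 hp1 hb0 hb1
  have hinf := D.infinite_sqrtZeros BigQBessel.not_finiteDimensional_lp
  have hfin := D.finite_sqrtZeros_inter
  rw [← BigQBessel.positiveZeros_eq] at hinf
  simp only [← BigQBessel.positiveZeros_eq] at hfin
  obtain ⟨hmono, hrange⟩ := BigQBessel.besselZero_enumerates hinf hfin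
  have hmem : ∀ k, BigQBessel.besselZero q α k ∈
      BigQBessel.sqrtZeros (BigQBessel.besselSeries (q ^ 2) (q ^ (2 * α + 2)) 1) := by
    intro k
    rw [← BigQBessel.positiveZeros_eq, ← hrange]
    exact ⟨k, rfl⟩
  have hsamp := fun k => BigQBessel.samplingFunction_eq hq0 hq1 hα hp0 hp1 hb0 hb1 (hmem k)
  set e : ℕ ≃ BigQBessel.sqrtZeros (BigQBessel.besselSeries (q ^ 2) (q ^ (2 * α + 2)) 1) :=
    Equiv.ofBijective (fun k => ⟨BigQBessel.besselZero q α k, hmem k⟩)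
      ⟨fun i j hij => hmono.injective (congrArg Subtype.val hij), fun t => by
        have ht : (t : ℝ) ∈ Set.range (BigQBessel.besselZero q α) := by
          rw [hrange, BigQBessel.positiveZeros_eq]
          exact t.2
        obtain ⟨k, hk⟩ := ht
        exact ⟨k, Subtype.ext hk⟩⟩
  refine ⟨hmono, hrange, fun k => ?_, fun k => ?_, fun f hf => ⟨fun l => ?_, fun l => ?_,
    fun K hK => ?_⟩⟩
  · rw [BigQBessel.deriv_bigQBessel_one hq0 hq1 hα]
    have h0 : (BigQBessel.besselZero q α k : ℂ) ≠ 0 := by exact_mod_cast (hmem k).1.ne'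
    exact mul_ne_zero (mul_ne_zero two_ne_zero h0) (D.deriv_charFun_ne_zero (hmem k))
  · rw [funext (hsamp k)]
    exact (((innerSL ℂ _).differentiable.comp D.differentiable).comp
      (differentiable_pow 2)).div_const _
  · exact (BigQBessel.hasSum_hankelIntegrand hq0 hq1 hα hp0 hp1 hb0 hb1 hf l).summable
  · simp only [BigQBessel.hankelTransform_eq hq0 hq1 hα hp0 hp1 hb0 hb1 hf, hsamp, mul_assoc]
    exact ((e.hasSum_iff).2 (D.hasSum_inner _ (l ^ 2))).mul_left _
  · rw [funext (BigQBessel.hankelTransform_eq hq0 hq1 hα hp0 hp1 hb0 hb1 hf)]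
    simp only [hsamp, mul_assoc, ← Finset.mul_sum]
    have h1 := (D.tendstoUniformlyOn_inner e
      (⟨_, BigQBessel.memℓp_signalFun hq0 hq1 hα hf⟩ : lp (fun _ : ℕ ⊕ ℕ => ℂ) 2)
      (hK.image (continuous_pow 2))).comp fun l : ℂ => l ^ 2
    have h2 := (h1.mono fun l hl => ⟨l, hl, rfl⟩ : TendstoUniformlyOn _ _ _ K)
    have h3 := (uniformContinuous_mul_left' (((1 - q : ℝ) : ℂ))).comp_tendstoUniformlyOn h2
    exact h3
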